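/- Let $k\ge 1$ be an integer, $n=k^2$ and $[n]=\{1,\dots,n\}$. Divide the cells of an $n\times n$ matrix into $k^2$ blocks of size $k\times k$: for $i,j\in\{1,\dots,k\}$, the $(i,j)$th block consists of the cells $((i-1)k+x,(j-1)k+y)$ with $1\le x,y\le k$. A partial Sudoku square of order $n$ is an $n\times n$ matrix with entries in $[n]\cup\{*\}$, where $*$ marks an empty cell, such that every element of $[n]$ appears at most once in each row, at most once in each column and at most once in each block; a Sudoku square of order $n$ is a partial Sudoku square without empty cells. For $0\le m<n$, an $m\times n$ Sudoku rectangle is a partial Sudoku square of order $n$ in which all cells of the first $m$ rows are filled and all other cells are empty. It can be completed to a Sudoku square if there is a Sudoku square of order $n$ that agrees with it on all of its filled cells. Theorem. Let $m=lk+r$ with integers $0\le l<k$ and $0\le r<k$. Then every $m\times n$ Sudoku rectangle can be completed to a Sudoku square of order $n$ if and only if at least one of the following conditions holds: (1) $l=k-1$; (2) $r=0$; (3) $(k-r)(k-l)\ge lk$. -/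

import Mathlib

/-- An `n × n` matrix with entries from `[n] ∪ {*}`. Rows, columns and symbols are indexed by
`Fin n = {0, …, n - 1}`, and `none` is the empty entry `*`. -/
abbrev PartialMatrix (n : ℕ) : Type := Matrix (Fin n) (Fin n) (Option (Fin n))

/-- Row condition: every symbol appears at most once in each row. -/
def RowCondition {n : ℕ} (P : PartialMatrix n) : Prop :=
  ∀ (x i j j' : Fin n), P i j = some x → P i j' = some x → j = j'

/-- Column condition: every symbol appears at most once in each column. -/
def ColumnCondition {n : ℕ} (P : PartialMatrix n) : Prop :=
  ∀ (x i i' j : Fin n), P i j = some x → P i' j = some x → i = i'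

/-- Two cells lie in the same `k × k` block. With indices starting at `0`, the cell `(i, j)` lies
in the block with coordinates `(i / k, j / k)`. -/
def SameBlock (k : ℕ) {n : ℕ} (c c' : Fin n × Fin n) : Prop :=
  (c.1 : ℕ) / k = (c'.1 : ℕ) / k ∧ (c.2 : ℕ) / k = (c'.2 : ℕ) / k

/-- Block condition: every symbol appears at most once in each `k × k` block. -/
def BlockCondition (k : ℕ) {n : ℕ} (P : PartialMatrix n) : Prop :=
  ∀ (x : Fin n) (c c' : Fin n × Fin n), SameBlock k c c' →
    P c.1 c.2 = some x → P c'.1 c'.2 = some x → c = c'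

/-- Partial Sudoku squares of order `n` (where `n = k ^ 2`). -/
structure IsPartialSudokuSquare (k : ℕ) {n : ℕ} (P : PartialMatrix n) : Prop where
  row : RowCondition P
  column : ColumnCondition P
  block : BlockCondition k P

/-- A matrix with entries from `[n]`, regarded as a matrix over `[n] ∪ {*}` without empty cells. -/
def filled {n : ℕ} (S : Matrix (Fin n) (Fin n) (Fin n)) : PartialMatrix n :=
  fun i j => some (S i j)

/-- Sudoku squares of order `n` (where `n = k ^ 2`): `n × n` matrices with entries from `[n]`
that satisfy the row, column and block conditions. -/
def IsSudokuSquare (k : ℕ) {n : ℕ} (S : Matrix (Fin n) (Fin n) (Fin n)) : Prop :=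
  IsPartialSudokuSquare k (filled S)

/-- `Q` extends `P`: every nonempty entry of `P` is kept in `Q`. -/
def IsExtension {n : ℕ} (Q P : PartialMatrix n) : Prop :=
  ∀ i j : Fin n, P i j ≠ none → P i j = Q i j

/-- `m × n` Sudoku rectangles (where `n = k ^ 2`): partial Sudoku squares of order `n` in which
all cells in the first `m` rows are filled and all remaining cells are empty. -/
structure IsSudokuRectangle (k m : ℕ) {n : ℕ} (R : PartialMatrix n) : Prop where
  isPartial : IsPartialSudokuSquare k R
  filled_of_lt : ∀ i j : Fin n, (i : ℕ) < m → R i j ≠ none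
  empty_of_le : ∀ i j : Fin n, m ≤ (i : ℕ) → R i j = none

/-- `P` can be completed to a Sudoku square. -/
def IsCompletable (k : ℕ) {n : ℕ} (P : PartialMatrix n) : Prop :=
  ∃ S : Matrix (Fin n) (Fin n) (Fin n), IsSudokuSquare k S ∧ IsExtension (filled S) P

/-! Record only the column of each symbol in each block: let `F b s x` be the column of stack `s`
holding `x` in band `b`. Such data come from a Sudoku square as soon as every column of every block
receives `k` symbols and, for each stack and symbol, the columns in different bands differ. Indeed,
within a band, joining each column to the symbols assigned to it and not yet placed in its block
gives a regular bipartite graph, and the classes of an edge colouring are the missing rows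
(`exists_band_completion`). Different stacks no longer interact.

Sufficiency is therefore a question about one stack. Empty bands cause no difficulty: the pairs
(symbol, unused column) form a biregular relation, which splits into balanced assignments. Only the
partly filled band `l` is critical: its `k * (k - r)` absent symbols must be distributed evenly over
the `k` columns, avoiding columns already used. Hall's condition follows from degree counting if `r
= 0` or `l = k - 1`. Under (3), a set `X` whose neighbourhood misses a column has at most `l * k`
elements, because all of `X` already occurs in that column, while its neighbourhood contains at
least `k - l` columns.

For necessity, put `q = k - r` and `d = k - l`. If `q * d < l * k`, `l ≥ 1`, `d ≥ 2` and `r ≥ 1`,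
one can arrange that in the first stack a set `X` of `q * d + 1` symbols occupies each of the first
`l` columns within the first `l` bands and is absent from the `r` given rows of band `l`. Then `X`
would have to fit into the `q * d` cells in the other rows and columns of that block. The other
symbols are dealt cyclically to the columns (`exists_cyclic_relation`), Hall's theorem supplies the
`r` extra rows, and cyclic shifts carry the pattern to the other stacks. -/

/-! ### Matchings and decompositions of bipartite multigraphs -/

open Finset in
open scoped Classical in
/-- A nonempty regular bipartite multigraph has a perfect matching. -/
theorem exists_matching_of_regular {ε α β : Type*} [Fintype α] [Fintype β]
    (E : Finset ε) (u : ε → α) (v : ε → β) (D : ℕ)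
    (hu : ∀ a, #{e ∈ E | u e = a} = D + 1) (hv : ∀ b, #{e ∈ E | v e = b} = D + 1) :
    ∃ M ⊆ E, (∀ a, #{e ∈ M | u e = a} = 1) ∧ (∀ b, #{e ∈ M | v e = b} = 1) := by
  have hall : ∀ A : Finset α, #A ≤ #(A.biUnion fun a => image v {e ∈ E | u e = a}) := by
    intro A
    set N := A.biUnion fun a => image v {e ∈ E | u e = a} with hN
    have h1 : #{e ∈ E | u e ∈ A} = #A * (D + 1) := by
      rw [card_eq_sum_card_fiberwise (f := u) (t := A) (by intro e he; simpa using (by simpa using he : e ∈ E ∧ u e ∈ A).2)]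
      rw [← smul_eq_mul, ← sum_const]
      refine sum_congr rfl fun a ha => ?_
      rw [← hu a, filter_filter]
      congr 1
      ext e
      simp only [mem_filter]
      constructor
      · rintro ⟨h, -, h'⟩; exact ⟨h, h'⟩
      · rintro ⟨h, h'⟩; exact ⟨h, h' ▸ ha, h'⟩
    have h2 : #{e ∈ E | u e ∈ A} ≤ #N * (D + 1) := by
      have hsub : ∀ e ∈ ({e ∈ E | u e ∈ A} : Finset ε), v e ∈ N := by
        intro e he
        simp only [mem_filter] at he
        simp only [hN, mem_biUnion, mem_image, mem_filter]
        exact ⟨u e, he.2, e, ⟨he.1, rfl⟩, rfl⟩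
      rw [card_eq_sum_card_fiberwise hsub, ← smul_eq_mul, ← sum_const]
      refine sum_le_sum fun b _ => ?_
      rw [← hv b]
      refine card_le_card fun e he => ?_
      simp only [mem_filter] at he ⊢
      exact ⟨he.1.1, he.2⟩
    exact Nat.le_of_mul_le_mul_right (h1 ▸ h2) (Nat.succ_pos D)
  obtain ⟨f, hf, hmem⟩ := (all_card_le_biUnion_card_iff_exists_injective _).1 hall
  have hcard : Fintype.card α = Fintype.card β := by
    have h1 : #E = Fintype.card α * (D + 1) := by
      rw [card_eq_sum_card_fiberwise (f := u) (t := univ) (by intro e _; simp)]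
      simp [hu]
    have h2 : #E = Fintype.card β * (D + 1) := by
      rw [card_eq_sum_card_fiberwise (f := v) (t := univ) (by intro e _; simp)]
      simp [hv]
    exact Nat.eq_of_mul_eq_mul_right (Nat.succ_pos D) (h1.symm.trans h2)
  have hbij : Function.Bijective f := (Fintype.bijective_iff_injective_and_card f).2 ⟨hf, hcard⟩
  simp only [mem_image, mem_filter] at hmem
  choose g hg using hmem
  refine ⟨univ.image g, ?_, ?_, ?_⟩
  · intro e he
    obtain ⟨a, -, rfl⟩ := mem_image.1 he
    exact (hg a).1.1
  · intro a
    rw [card_eq_one]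
    refine ⟨g a, ?_⟩
    ext e
    simp only [mem_filter, mem_image, mem_univ, true_and, mem_singleton]
    constructor
    · rintro ⟨⟨a', rfl⟩, h⟩
      rw [(hg a').1.2] at h
      rw [h]
    · rintro rfl
      exact ⟨⟨a, rfl⟩, (hg a).1.2⟩
  · intro b
    obtain ⟨a, rfl⟩ := hbij.2 b
    rw [card_eq_one]
    refine ⟨g a, ?_⟩
    ext e
    simp only [mem_filter, mem_image, mem_univ, true_and, mem_singleton]
    constructor
    · rintro ⟨⟨a', rfl⟩, h⟩
      rw [(hg a').2] at h
      rw [hf h]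
    · rintro rfl
      exact ⟨⟨a, rfl⟩, (hg a).2⟩

open Finset in
open scoped Classical in
/-- A `D`-regular bipartite multigraph decomposes into `D` perfect matchings. -/
theorem exists_coloring_of_regular {ε α β : Type*} [Fintype α] [Fintype β]
    (u : ε → α) (v : ε → β) (D : ℕ) (E : Finset ε)
    (hu : ∀ a, #{e ∈ E | u e = a} = D) (hv : ∀ b, #{e ∈ E | v e = b} = D) :
    ∃ col : ε → ℕ, (∀ e ∈ E, col e < D) ∧
      (∀ a, ∀ i < D, #{e ∈ E | u e = a ∧ col e = i} = 1) ∧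
      (∀ b, ∀ i < D, #{e ∈ E | v e = b ∧ col e = i} = 1) := by
  induction D generalizing E with
  | zero =>
    refine ⟨fun _ => 0, fun e he => ?_, by simp, by simp⟩
    have := hu (u e)
    rw [card_eq_zero] at this
    exact absurd (this ▸ mem_filter.2 ⟨he, rfl⟩ : e ∈ (∅ : Finset ε)) (notMem_empty e)
  | succ D ih =>
    obtain ⟨M, hME, hMu, hMv⟩ := exists_matching_of_regular E u v D hu hv
    have key : ∀ p : ε → Prop, #{e ∈ E | p e} = D + 1 → #{e ∈ M | p e} = 1 →
        #{e ∈ E \ M | p e} = D := by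
      intro p h1 h2
      have : ({e ∈ E \ M | p e} : Finset ε) = {e ∈ E | p e} \ {e ∈ M | p e} := by
        ext e; simp only [mem_filter, mem_sdiff]; tauto
      rw [this, card_sdiff_of_subset (filter_subset_filter _ hME), h1, h2]
      rfl
    obtain ⟨col, hlt, hcu, hcv⟩ := ih (E \ M) (fun a => key _ (hu a) (hMu a))
      (fun b => key _ (hv b) (hMv b))
    -- The removed matching `M` receives the new colour `D`.
    have key2 : ∀ p : ε → Prop, #{e ∈ M | p e} = 1 →
        (∀ i < D, #{e ∈ E \ M | p e ∧ col e = i} = 1) → ∀ i < D + 1,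
        #{e ∈ E | p e ∧ (if e ∈ M then D else col e) = i} = 1 := by
      intro p h1 h2 i hi
      rcases Nat.lt_succ_iff_lt_or_eq.1 hi with hi | rfl
      · rw [← h2 i hi]
        congr 1
        ext e
        simp only [mem_filter, mem_sdiff]
        by_cases he : e ∈ M
        · simp only [he, if_true]
          constructor
          · rintro ⟨-, -, h⟩; omega
          · rintro ⟨⟨-, h⟩, -⟩; exact absurd trivial h
        · simp [he]
      · rw [← h1]
        congr 1
        ext e
        simp only [mem_filter]
        by_cases he : e ∈ M
        · simp [he, hME he]
        · simp only [he, if_false, false_and, iff_false]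
          rintro ⟨h, -, h'⟩
          have := hlt e (mem_sdiff.2 ⟨h, he⟩)
          omega
    refine ⟨fun e => if e ∈ M then D else col e, ?_, fun a => key2 _ (hMu a) (hcu a),
      fun b => key2 _ (hMv b) (hcv b)⟩
    intro e he
    by_cases h : e ∈ M
    · simp [h]
    · simp only [h, if_false]
      exact (hlt e (mem_sdiff.2 ⟨he, h⟩)).trans (Nat.lt_succ_self D)

open Finset in
open scoped Classical in
/-- A finite set of `D * q` elements can be divided into `q` parts of `D` elements. -/
theorem exists_equipartition {ε : Type*} (s : Finset ε) (D q : ℕ) (hq : 0 < q)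
    (hs : #s = D * q) : ∃ g : ε → Fin q, ∀ j, #{e ∈ s | g e = j} = D := by
  let φ : s ≃ Fin D × Fin q := (s.equivFinOfCardEq hs).trans finProdFinEquiv.symm
  refine ⟨fun e => if h : e ∈ s then (φ ⟨e, h⟩).2 else ⟨0, hq⟩, fun j => ?_⟩
  have hD : #(univ : Finset (Fin D)) = D := by simp
  conv_rhs => rw [← hD]
  symm
  refine card_bij (fun i _ => (φ.symm (i, j) : ε)) ?_ ?_ ?_
  · intro i _
    simp
  · intro i _ i' _ h
    have := φ.symm.injective (Subtype.ext h)
    simpa using this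
  · intro e he
    simp only [mem_filter] at he
    obtain ⟨h, h'⟩ := he
    rw [dif_pos h] at h'
    refine ⟨(φ ⟨e, h⟩).1, mem_univ _, ?_⟩
    rw [← h']
    simp

open Finset in
open scoped Classical in
/-- A bipartite multigraph with degrees `D * q` on one side and `D` on the other decomposes into
`D` subgraphs with degrees `q` and `1`. -/
theorem exists_coloring_of_biregular {ε α β : Type*} [Fintype α] [Fintype β]
    (u : ε → α) (v : ε → β) (D q : ℕ) (hq : 0 < q) (E : Finset ε)
    (hu : ∀ a, #{e ∈ E | u e = a} = D * q) (hv : ∀ b, #{e ∈ E | v e = b} = D) :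
    ∃ col : ε → ℕ, (∀ e ∈ E, col e < D) ∧
      (∀ a, ∀ i < D, #{e ∈ E | u e = a ∧ col e = i} = q) ∧
      (∀ b, ∀ i < D, #{e ∈ E | v e = b ∧ col e = i} = 1) := by
  -- Each vertex `a` is split into `q` vertices `(a, j)` of degree `D`, which reduces to the regular
  -- case.
  choose g hg using fun a => exists_equipartition _ D q hq (hu a)
  obtain ⟨col, hlt, hcu, hcv⟩ := exists_coloring_of_regular
    (fun e => (u e, g (u e) e)) v D E (by
      rintro ⟨a, j⟩
      rw [← hg a j, filter_filter]
      congr 1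
      ext e
      simp only [mem_filter, Prod.mk.injEq]
      constructor
      · rintro ⟨h, rfl, h'⟩; exact ⟨h, rfl, h'⟩
      · rintro ⟨h, rfl, h'⟩; exact ⟨h, rfl, h'⟩) hv
  refine ⟨col, hlt, fun a i hi => ?_, hcv⟩
  rw [card_eq_sum_card_fiberwise (f := g a) (t := univ) (by intro e _; simp)]
  rw [sum_congr rfl (g := fun _ => 1)]
  · simp
  · intro j _
    rw [← hcu (a, j) i hi, filter_filter]
    congr 1
    ext e
    simp only [mem_filter, Prod.mk.injEq]
    constructor
    · rintro ⟨h, ⟨rfl, h1⟩, h2⟩; exact ⟨h, ⟨rfl, h2⟩, h1⟩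
    · rintro ⟨h, ⟨rfl, h1⟩, h2⟩; exact ⟨h, ⟨rfl, h2⟩, h1⟩

open Finset in
open scoped Classical in
/-- Hall's theorem with capacities: if every set `X ⊆ V` has at least `#X / q` neighbours and
`#V = q * |κ|`, then `V` can be distributed over `κ` with exactly `q` elements at each vertex. -/
theorem exists_balanced_of_hall {σ κ : Type*} [Fintype κ] [DecidableEq κ] (V : Finset σ) (N : σ → Finset κ) (q : ℕ)
    (hV : #V = Fintype.card κ * q) (hall : ∀ X ⊆ V, #X ≤ #(X.biUnion N) * q) :
    ∃ f : V → κ, (∀ x : V, f x ∈ N x) ∧ ∀ c, #{x : V | f x = c} = q := by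
  -- Each element of `κ` is replaced by `q` copies, so that the ordinary Hall theorem applies.
  have h : ∀ X : Finset V, #X ≤ #(X.biUnion fun x : V => N x ×ˢ (univ : Finset (Fin q))) := by
    intro X
    have h1 := hall (X.map (Function.Embedding.subtype _)) (by
      intro x hx
      obtain ⟨y, -, rfl⟩ := mem_map.1 hx
      exact y.2)
    rw [card_map] at h1
    refine h1.trans (le_of_eq ?_)
    have : (X.biUnion fun x : V => N x ×ˢ (univ : Finset (Fin q))) =
        (X.map (Function.Embedding.subtype _)).biUnion N ×ˢ univ := by
      ext ⟨c, j⟩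
      simp
    rw [this, card_product]
    simp
  obtain ⟨g, hg, hmem⟩ := (all_card_le_biUnion_card_iff_exists_injective _).1 h
  have hbij : Function.Bijective g :=
    (Fintype.bijective_iff_injective_and_card g).2 ⟨hg, by simp [hV]⟩
  refine ⟨fun x => (g x).1, fun x => (mem_product.1 (hmem x)).1, fun c => ?_⟩
  have hq : #(univ : Finset (Fin q)) = q := by simp
  conv_rhs => rw [← hq]
  refine card_bij (fun x _ => (g x).2) (by simp) ?_ ?_
  · intro x hx y hy hxy
    simp only [mem_filter, mem_univ, true_and] at hx hy
    exact hg (Prod.ext (hx.trans hy.symm) hxy)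
  · intro j _
    obtain ⟨x, hx⟩ := hbij.2 (c, j)
    exact ⟨x, by simp [hx], by simp [hx]⟩

/-! ### From column assignments to completed arrays -/

open Finset in
open scoped Classical in
/-- A band of `k` rows whose first `h` rows are filled can be completed, provided that one is given
a balanced assignment `F` of the symbols in every stack to the columns of that stack that is
compatible with the filled rows. -/
theorem exists_band_completion {σ : Type*} [Fintype σ] {k h : ℕ} (hσ : Fintype.card σ = k * k)
    (hh : h ≤ k) (B : Fin k → Fin k → Fin k → Option σ)
    (hfill : ∀ ρ s c, (∃ x, B ρ s c = some x) ↔ (ρ : ℕ) < h)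
    (hrow : ∀ ρ s c s' c' x, B ρ s c = some x → B ρ s' c' = some x → s = s' ∧ c = c')
    (hcol : ∀ ρ ρ' s c x, B ρ s c = some x → B ρ' s c = some x → ρ = ρ')
    (F : Fin k → σ → Fin k) (hF : ∀ s c, #{x | F s x = c} = k)
    (hBF : ∀ ρ s c x, B ρ s c = some x → F s x = c) :
    ∃ S : Fin k → Fin k → Fin k → σ, (∀ ρ s c, F s (S ρ s c) = c) ∧
      (∀ ρ s c s' c', S ρ s c = S ρ s' c' → s = s' ∧ c = c') ∧
      (∀ ρ ρ' s c, S ρ s c = S ρ' s c → ρ = ρ') ∧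
      (∀ ρ s c x, B ρ s c = some x → S ρ s c = x) := by
  have hval : ∀ (ρ : Fin h) s c, ∃ x, B (ρ.castLE hh) s c = some x :=
    fun ρ s c => (hfill _ s c).2 ρ.2
  choose val hval using hval
  let present : Fin k → σ → Prop := fun s x => ∃ ρ c, B ρ s c = some x
  have hpres : ∀ s x, present s x ↔ ∃ ρ : Fin h, val ρ s (F s x) = x := by
    intro s x
    constructor
    · rintro ⟨ρ, c, hx⟩
      have hlt := (hfill ρ s c).1 ⟨x, hx⟩
      refine ⟨⟨ρ, hlt⟩, ?_⟩
      have := hval ⟨ρ, hlt⟩ s c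
      rw [hBF _ _ _ _ hx]
      exact Option.some_injective _ (this.symm.trans hx)
    · rintro ⟨ρ, hx⟩
      exact ⟨_, _, (hval ρ s (F s x)).trans (congrArg some hx)⟩
  have hvalF : ∀ ρ s c, F s (val ρ s c) = c := fun ρ s c => hBF _ _ _ _ (hval ρ s c)
  have hvalinj : ∀ ρ ρ' s c, val ρ s c = val ρ' s c → ρ = ρ' := by
    intro ρ ρ' s c he
    have := hcol _ _ _ _ _ (hval ρ s c) (he ▸ hval ρ' s c)
    simpa [Fin.ext_iff] using this
  -- A filled row has `k * k` distinct entries, hence contains every symbol once; this is why each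
  -- symbol is present in exactly `h` blocks of the band.
  have hvalbij : ∀ ρ, Function.Bijective fun p : Fin k × Fin k => val ρ p.1 p.2 := by
    intro ρ
    refine (Fintype.bijective_iff_injective_and_card _).2 ⟨?_, by simp [hσ]⟩
    rintro ⟨s, c⟩ ⟨s', c'⟩ he
    have h1 : val ρ s c = val ρ s' c' := he
    have := hrow _ _ _ _ _ _ (hval ρ s c) (h1 ▸ hval ρ s' c')
    exact Prod.ext this.1 this.2
  have hcardh : #(univ : Finset (Fin h)) = h := by simp
  have cnt1 : ∀ s c, #{x | F s x = c ∧ present s x} = h := by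
    intro s c
    conv_rhs => rw [← hcardh]
    symm
    refine card_bij (fun ρ _ => val ρ s c) ?_ ?_ ?_
    · intro ρ _
      simp only [mem_filter, mem_univ, true_and]
      exact ⟨hvalF ρ s c, _, _, hval ρ s c⟩
    · intro ρ _ ρ' _ he
      exact hvalinj _ _ _ _ he
    · intro x hx
      simp only [mem_filter, mem_univ, true_and] at hx
      obtain ⟨ρ, hρ⟩ := (hpres s x).1 hx.2
      exact ⟨ρ, mem_univ _, hx.1 ▸ hρ⟩
  have cnt2 : ∀ x, #{s | present s x} = h := by
    intro x
    conv_rhs => rw [← hcardh]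
    symm
    choose loc hloc using fun ρ => (hvalbij ρ).2 x
    have hloc2 : ∀ ρ, F (loc ρ).1 x = (loc ρ).2 := by
      intro ρ
      have := hvalF ρ (loc ρ).1 (loc ρ).2
      have h1 := hloc ρ
      simp only at h1
      rwa [h1] at this
    refine card_bij (fun ρ _ => (loc ρ).1) ?_ ?_ ?_
    · intro ρ _
      simp only [mem_filter, mem_univ, true_and]
      exact ⟨_, _, (hval ρ (loc ρ).1 (loc ρ).2).trans (congrArg some (hloc ρ))⟩
    · intro ρ _ ρ' _ he
      have h2 : (loc ρ).2 = (loc ρ').2 := by rw [← hloc2, ← hloc2, he]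
      have h3 := hloc ρ
      have h4 := hloc ρ'
      simp only at h3 h4
      rw [← he, ← h2] at h4
      exact hvalinj _ _ _ _ (h3.trans h4.symm)
    · intro s hs
      simp only [mem_filter, mem_univ, true_and] at hs
      obtain ⟨ρ, hρ⟩ := (hpres s x).1 hs
      have := (hvalbij ρ).1 (a₁ := (s, F s x)) (a₂ := loc ρ) (hρ.trans (hloc ρ).symm)
      exact ⟨ρ, mem_univ _, by rw [← this]⟩
  -- The edge `(s, x)` joins column `F s x` of stack `s` to symbol `x`. All degrees are `k - h`, and
  -- colour `i` will become row `h + i`.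
  let E : Finset (Fin k × σ) := {e | ¬ present e.1 e.2}
  obtain ⟨col, hlt, hcu, hcv⟩ := exists_coloring_of_regular
    (fun e : Fin k × σ => (e.1, F e.1 e.2)) (fun e => e.2) (k - h) E (by
      rintro ⟨s, c⟩
      have h1 : #{x | F s x = c ∧ ¬ present s x} = k - h := by
        have := card_filter_add_card_filter_not (s := ({x | F s x = c} : Finset σ)) (present s)
        rw [filter_filter, filter_filter, hF, cnt1] at this
        omega
      rw [← h1]
      refine card_bij (fun e _ => e.2) ?_ ?_ ?_
      · rintro ⟨s', x⟩ he
        simp only [E, mem_filter, mem_univ, true_and, Prod.mk.injEq] at he ⊢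
        exact ⟨he.2.1 ▸ he.2.2, he.2.1 ▸ he.1⟩
      · rintro ⟨s', x⟩ he ⟨s'', x'⟩ he' hx
        simp only [E, mem_filter, mem_univ, true_and, Prod.mk.injEq] at he he' hx ⊢
        exact ⟨he.2.1.trans he'.2.1.symm, hx⟩
      · intro x hx
        simp only [mem_filter, mem_univ, true_and] at hx
        exact ⟨(s, x), by simp [E, hx.1, hx.2], rfl⟩) (by
      intro x
      have h1 : #{s | ¬ present s x} = k - h := by
        have := card_filter_add_card_filter_not (s := (univ : Finset (Fin k)))
          (fun s => present s x)
        rw [cnt2, card_univ, Fintype.card_fin] at this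
        omega
      rw [← h1]
      refine card_bij (fun e _ => e.1) ?_ ?_ ?_
      · rintro ⟨s', x⟩ he
        simp only [E, mem_filter, mem_univ, true_and] at he ⊢
        exact he.2 ▸ he.1
      · rintro ⟨s', x⟩ he ⟨s'', x'⟩ he' hx
        simp only [E, mem_filter, mem_univ, true_and, Prod.mk.injEq] at he he' hx ⊢
        exact ⟨hx, he.2.trans he'.2.symm⟩
      · intro s hs
        simp only [mem_filter, mem_univ, true_and] at hs
        exact ⟨(s, x), by simp [E, hs], rfl⟩)
  have hex : ∀ ρ s c, ∃ x, (B ρ s c = some x) ∨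
      (h ≤ (ρ : ℕ) ∧ ¬ present s x ∧ F s x = c ∧ col (s, x) = ρ - h) := by
    intro ρ s c
    by_cases hρ : (ρ : ℕ) < h
    · obtain ⟨x, hx⟩ := (hfill ρ s c).2 hρ
      exact ⟨x, Or.inl hx⟩
    · have := hcu (s, c) (ρ - h) (by omega)
      obtain ⟨⟨s', x⟩, hx⟩ := card_pos.1 (this ▸ Nat.one_pos)
      simp only [E, mem_filter, mem_univ, true_and, Prod.mk.injEq] at hx
      obtain ⟨h1, ⟨rfl, h2⟩, h3⟩ := hx
      exact ⟨x, Or.inr ⟨by omega, h1, h2, h3⟩⟩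
  choose S hS using hex
  have hSF : ∀ ρ s c, F s (S ρ s c) = c := by
    intro ρ s c
    rcases hS ρ s c with h1 | h1
    · exact hBF _ _ _ _ h1
    · exact h1.2.2.1
  have hBlt : ∀ ρ s c x, B ρ s c = some x → (ρ : ℕ) < h := fun ρ s c x hx => (hfill ρ s c).1 ⟨x, hx⟩
  refine ⟨S, hSF, ?_, ?_, ?_⟩
  · intro ρ s c s' c' he
    rcases hS ρ s c with h1 | h1 <;> rcases hS ρ s' c' with h2 | h2
    · exact hrow _ _ _ _ _ _ h1 (he ▸ h2)
    · have := hBlt _ _ _ _ h1; omega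
    · have := hBlt _ _ _ _ h2; omega
    · have hs : s = s' := by
        have := hcv (S ρ s c) (ρ - h) (by omega)
        have := card_le_one.1 this.le (s, S ρ s c) (by simp [E, h1.2.1, h1.2.2.2])
          (s', S ρ s c) (by rw [he]; simp [E, h2.2.1, h2.2.2.2])
        exact congrArg Prod.fst this
      subst hs
      exact ⟨rfl, by rw [← hSF ρ s c, he, hSF]⟩
  · intro ρ ρ' s c he
    rcases hS ρ s c with h1 | h1 <;> rcases hS ρ' s c with h2 | h2
    · exact hcol _ _ _ _ _ h1 (he ▸ h2)
    · exact absurd ⟨_, _, he ▸ h1⟩ h2.2.1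
    · exact absurd ⟨_, _, he ▸ h2⟩ h1.2.1
    · have h3 := h1.2.2.2
      rw [he, h2.2.2.2] at h3
      exact Fin.ext (by omega)
  · intro ρ s c x hx
    rcases hS ρ s c with h1 | h1
    · exact Option.some_injective _ (h1.symm.trans hx)
    · have := hBlt _ _ _ _ hx; omega

open Finset in
open scoped Classical in
/-- The number of symbols assigned to a given column in one of the first `l` bands. -/
theorem card_used_symbols {σ : Type*} [Fintype σ] {k l : ℕ} (hl : l ≤ k) (F : Fin k → σ → Fin k)
    (hF : ∀ b : Fin k, (b : ℕ) < l → ∀ c, #{x | F b x = c} = k)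
    (hinj : ∀ b b' : Fin k, (b : ℕ) < l → (b' : ℕ) < l → ∀ x, F b x = F b' x → b = b')
    (c : Fin k) : #{x | ∃ b : Fin k, (b : ℕ) < l ∧ F b x = c} = k * l := by
  have hcardl : #({b : Fin k | (b : ℕ) < l} : Finset (Fin k)) = l := by
    rw [Fin.card_filter_val_lt]; omega
  have : ({x | ∃ b : Fin k, (b : ℕ) < l ∧ F b x = c} : Finset σ) =
      ({b : Fin k | (b : ℕ) < l} : Finset (Fin k)).biUnion fun b => {x | F b x = c} := by
    ext x; simp
  rw [this, card_biUnion]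
  · rw [sum_congr rfl (g := fun _ => k)]
    · rw [sum_const, hcardl, smul_eq_mul, mul_comm]
    · intro b hb
      exact hF b (by simpa using hb) c
  · intro b hb b' hb' hne
    rw [Function.onFun, disjoint_left]
    intro x hx hx'
    simp only [mem_filter, mem_univ, true_and, coe_filter, Set.mem_ofPred_eq] at hx hx' hb hb'
    exact hne (hinj b b' hb hb' x (hx.trans hx'.symm))

open Finset in
open scoped Classical in
/-- The number of columns to which a given symbol is assigned in the first `l` bands. -/
theorem card_used_columns {σ : Type*} {k l : ℕ} (hl : l ≤ k) (F : Fin k → σ → Fin k)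
    (hinj : ∀ b b' : Fin k, (b : ℕ) < l → (b' : ℕ) < l → ∀ x, F b x = F b' x → b = b')
    (x : σ) : #{c | ∃ b : Fin k, (b : ℕ) < l ∧ F b x = c} = l := by
  have hcardl : #({b : Fin k | (b : ℕ) < l} : Finset (Fin k)) = l := by
    rw [Fin.card_filter_val_lt]; omega
  have : ({c | ∃ b : Fin k, (b : ℕ) < l ∧ F b x = c} : Finset (Fin k)) =
      ({b : Fin k | (b : ℕ) < l} : Finset (Fin k)).image fun b => F b x := by
    ext c; simp
  rw [this, card_image_of_injOn, hcardl]
  intro b hb b' hb' he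
  simp only [coe_filter, mem_univ, true_and, Set.mem_ofPred_eq] at hb hb'
  exact hinj b b' hb hb' x he

open Finset in
open scoped Classical in
/-- A relation between symbols and the columns of a stack with `D` columns for each symbol and
`D * k` symbols for each column splits into `D` balanced assignments of columns to symbols. -/
theorem exists_assignments_of_biregular {σ : Type*} [Fintype σ] {k : ℕ} (hk : 0 < k) (D : ℕ)
    (P : σ → Fin k → Prop) (hc : ∀ c, #{x | P x c} = D * k) (hx : ∀ x, #{c | P x c} = D) :
    ∃ F : ℕ → σ → Fin k, (∀ i < D, ∀ c, #{x | F i x = c} = k) ∧ (∀ i < D, ∀ x, P x (F i x)) ∧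
      (∀ i < D, ∀ j < D, ∀ x, F i x = F j x → i = j) ∧
      ∀ x c, P x c → ∃ i < D, F i x = c := by
  let E : Finset (σ × Fin k) := {e | P e.1 e.2}
  obtain ⟨col, hlt, hcu, hcv⟩ := exists_coloring_of_biregular
    (fun e : σ × Fin k => e.2) (fun e => e.1) D k hk E (by
      intro c
      rw [← hc c]
      refine card_bij (fun e _ => e.1) ?_ ?_ ?_
      · rintro ⟨x, c'⟩ he
        simp only [E, mem_filter, mem_univ, true_and] at he ⊢
        exact he.2 ▸ he.1
      · rintro ⟨x, c'⟩ he ⟨x', c''⟩ he' hx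
        simp only [E, mem_filter, mem_univ, true_and, Prod.mk.injEq] at he he' hx ⊢
        exact ⟨hx, he.2.trans he'.2.symm⟩
      · intro x hx
        simp only [mem_filter, mem_univ, true_and] at hx
        exact ⟨(x, c), by simp [E, hx], rfl⟩) (by
      intro x
      refine Eq.trans ?_ (hx x)
      refine card_bij (fun e _ => e.2) ?_ ?_ ?_
      · rintro ⟨x', c⟩ he
        simp only [E, mem_filter, mem_univ, true_and] at he ⊢
        exact he.2 ▸ he.1
      · rintro ⟨x', c⟩ he ⟨x'', c'⟩ he' hx
        simp only [E, mem_filter, mem_univ, true_and, Prod.mk.injEq] at he he' hx ⊢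
        exact ⟨he.2.trans he'.2.symm, hx⟩
      · intro c hc
        simp only [mem_filter, mem_univ, true_and] at hc
        exact ⟨(x, c), by simp [E, hc], rfl⟩)
  have hex : ∀ i x, ∃ c, i < D → P x c ∧ col (x, c) = i := by
    intro i x
    by_cases hi : i < D
    · have := hcv x i hi
      obtain ⟨⟨x', c⟩, hx⟩ := card_pos.1 (this ▸ Nat.one_pos)
      simp only [E, mem_filter, mem_univ, true_and] at hx
      obtain ⟨h1, rfl, h3⟩ := hx
      exact ⟨c, fun _ => ⟨h1, h3⟩⟩
    -- An arbitrary value: only the indices below `D` matter.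
    · exact ⟨⟨0, hk⟩, fun h => absurd h hi⟩
  choose C hC using hex
  have huniq : ∀ i < D, ∀ x c, P x c → col (x, c) = i → C i x = c := by
    intro i hi x c h1 h2
    have := card_le_one.1 (hcv x i hi).le (x, C i x)
      (by simp [E, hC i x hi]) (x, c) (by simp [E, h1, h2])
    exact congrArg Prod.snd this
  refine ⟨C, ?_, fun i hi x => (hC i x hi).1, ?_, ?_⟩
  · intro i hi c
    refine Eq.trans ?_ (hcu c i hi)
    refine card_bij (fun x _ => (x, c)) ?_ ?_ ?_
    · intro x hx
      simp only [mem_filter, mem_univ, true_and, E] at hx ⊢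
      exact ⟨hx ▸ (hC i x hi).1, hx ▸ (hC i x hi).2⟩
    · intro x _ x' _ he
      exact congrArg Prod.fst he
    · rintro ⟨x, c'⟩ he
      simp only [mem_filter, mem_univ, true_and, E] at he
      obtain ⟨h1, rfl, h2⟩ := he
      exact ⟨x, by simpa using huniq i hi x c' h1 h2, rfl⟩
  · intro i hi j hj x he
    have h1 := (hC i x hi).2
    rw [he, (hC j x hj).2] at h1
    exact h1.symm
  · intro x c h
    have hi := hlt (x, c) (by simpa [E] using h)
    exact ⟨_, hi, huniq _ hi x c h rfl⟩

open Finset in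
open scoped Classical in
/-- In one stack, a balanced assignment of the symbols to columns for the first `l` bands extends
to all bands. -/
theorem exists_column_assignment_extension {σ : Type*} [Fintype σ] {k l : ℕ}
    (hσ : Fintype.card σ = k * k) (hk : 0 < k) (hl : l ≤ k) (F : Fin k → σ → Fin k)
    (hF : ∀ b : Fin k, (b : ℕ) < l → ∀ c, #{x | F b x = c} = k)
    (hinj : ∀ b b' : Fin k, (b : ℕ) < l → (b' : ℕ) < l → ∀ x, F b x = F b' x → b = b') :
    ∃ G : Fin k → σ → Fin k, (∀ b : Fin k, (b : ℕ) < l → G b = F b) ∧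
      (∀ b c, #{x | G b x = c} = k) ∧ ∀ x, Function.Injective fun b => G b x := by
  let used : σ → Fin k → Prop := fun x c => ∃ b : Fin k, (b : ℕ) < l ∧ F b x = c
  have cnt1 : ∀ c, #{x | used x c} = k * l := card_used_symbols hl F hF hinj
  have cnt2 : ∀ x, #{c | used x c} = l := card_used_columns hl F hinj
  -- The columns still unused by each symbol form a biregular relation; its `k - l` parts serve the
  -- bands from `l` on.
  obtain ⟨C, hC1, hC2, hC3, -⟩ := exists_assignments_of_biregular hk (k - l)
    (fun x c => ¬ used x c) (by
      intro c
      have h1 : #{x | ¬ used x c} = (k - l) * k := by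
        have := card_filter_add_card_filter_not (s := (univ : Finset σ)) (fun x => used x c)
        rw [cnt1, card_univ, hσ] at this
        rw [Nat.sub_mul, mul_comm l]
        omega
      convert h1) (by
      intro x
      have h1 : #{c | ¬ used x c} = k - l := by
        have := card_filter_add_card_filter_not (s := (univ : Finset (Fin k))) (fun c => used x c)
        rw [cnt2, card_univ, Fintype.card_fin] at this
        omega
      convert h1)
  refine ⟨fun b x => if l ≤ (b : ℕ) then C (b - l) x else F b x, ?_, ?_, ?_⟩
  · intro b hb
    funext x
    exact if_neg (by omega)
  · intro b c
    by_cases hb : l ≤ (b : ℕ)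
    · simp only [hb, if_true]
      exact hC1 _ (by omega) c
    · simp only [hb, if_false]
      exact hF b (by omega) c
  · intro x b b' he
    simp only at he
    by_cases hb : l ≤ (b : ℕ) <;> by_cases hb' : l ≤ (b' : ℕ) <;>
      simp only [hb, hb', if_true, if_false] at he
    · have := hC3 _ (by omega) _ (by omega) x he
      exact Fin.ext (by omega)
    · exact absurd ⟨b', by omega, he.symm⟩ (hC2 _ (by omega) x)
    · exact absurd ⟨b, by omega, he⟩ (hC2 _ (by omega) x)
    · exact hinj b b' (by omega) (by omega) x he

/-- The Sudoku conditions for an array indexed by band, row of the band, stack and column of the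
stack. -/
structure IsSudokuArray {σ : Type*} {k : ℕ} (A : Fin k → Fin k → Fin k → Fin k → Option σ) :
    Prop where
  row : ∀ b ρ s c s' c' x, A b ρ s c = some x → A b ρ s' c' = some x → s = s' ∧ c = c'
  column : ∀ b ρ b' ρ' s c x, A b ρ s c = some x → A b' ρ' s c = some x → b = b' ∧ ρ = ρ'
  block : ∀ b ρ ρ' s c c' x, A b ρ s c = some x → A b ρ' s c' = some x → ρ = ρ' ∧ c = c'

open Finset in
open scoped Classical in
/-- An array whose bands are filled from the top can be completed as soon as a compatible
assignment of columns to all symbols in all blocks is known. -/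
theorem IsSudokuArray.exists_completion {σ : Type*} [Fintype σ] {k : ℕ}
    {A : Fin k → Fin k → Fin k → Fin k → Option σ} (hA : IsSudokuArray A)
    (hσ : Fintype.card σ = k * k) (h : Fin k → ℕ) (hh : ∀ b, h b ≤ k)
    (hfill : ∀ b ρ s c, (∃ x, A b ρ s c = some x) ↔ (ρ : ℕ) < h b)
    (F : Fin k → Fin k → σ → Fin k) (hF : ∀ b s c, #{x | F b s x = c} = k)
    (hinj : ∀ s x, Function.Injective fun b => F b s x)
    (hAF : ∀ b ρ s c x, A b ρ s c = some x → F b s x = c) :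
    ∃ S : Fin k → Fin k → Fin k → Fin k → σ, IsSudokuArray (fun b ρ s c => some (S b ρ s c)) ∧
      (∀ b ρ s c, F b s (S b ρ s c) = c) ∧
      ∀ b ρ s c x, A b ρ s c = some x → S b ρ s c = x := by
  choose S hSF hrow hcol hext using fun b => exists_band_completion hσ (hh b) (A b) (hfill b)
    (fun ρ s c s' c' x => hA.row b ρ s c s' c' x)
    (fun ρ ρ' s c x h1 h2 => (hA.column b ρ b ρ' s c x h1 h2).2) (F b) (hF b) (hAF b)
  refine ⟨S, ⟨?_, ?_, ?_⟩, hSF, hext⟩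
  · intro b ρ s c s' c' x h1 h2
    exact hrow b ρ s c s' c' (Option.some_injective _ (h1.trans h2.symm))
  · intro b ρ b' ρ' s c x h1 h2
    have he : S b ρ s c = S b' ρ' s c := Option.some_injective _ (h1.trans h2.symm)
    -- Bands were completed independently; equal symbols in one column have the same `F`-value, so
    -- injectivity in the band excludes a clash.
    have hb : b = b' := by
      apply hinj s (S b ρ s c)
      simp only
      rw [hSF, he, hSF]
    subst hb
    exact ⟨rfl, hcol _ _ _ _ _ he⟩
  · intro b ρ ρ' s c c' x h1 h2
    have he : S b ρ s c = S b ρ' s c' := Option.some_injective _ (h1.trans h2.symm)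
    have hc : c = c' := by rw [← hSF b ρ s c, he, hSF]
    subst hc
    exact ⟨hcol _ _ _ _ _ he, rfl⟩

/-! ### Sufficiency in one stack: Hall's condition for the partly filled band -/

open Finset in
open scoped Classical in
/-- Within one stack, the columns of the symbols can be chosen in all bands, compatibly with a
filled part consisting of `l` bands and `r` further rows. -/
theorem exists_column_assignment {σ : Type*} [Fintype σ] {k l r : ℕ}
    (hσ : Fintype.card σ = k * k) (hl : l < k) (hr : r < k)
    (hlr : r * (k - l) ≤ r ∨ l * k ≤ (k - r) * (k - l))
    (A : Fin k → Fin k → Fin k → Option σ)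
    (hfill : ∀ b ρ c, (∃ x, A b ρ c = some x) ↔ ((b : ℕ) < l ∨ (b : ℕ) = l ∧ (ρ : ℕ) < r))
    (hcol : ∀ b ρ b' ρ' c x, A b ρ c = some x → A b' ρ' c = some x → b = b' ∧ ρ = ρ')
    (hblock : ∀ b ρ ρ' c c' x, A b ρ c = some x → A b ρ' c' = some x → ρ = ρ' ∧ c = c') :
    ∃ F : Fin k → σ → Fin k, (∀ b c, #{x | F b x = c} = k) ∧
      (∀ x, Function.Injective fun b => F b x) ∧ ∀ b ρ c x, A b ρ c = some x → F b x = c := by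
  have hk : 0 < k := by omega
  have hval : ∀ (b ρ : Fin k) c, ∃ x, ((b : ℕ) < l ∨ (b : ℕ) = l ∧ (ρ : ℕ) < r) → A b ρ c = some x := by
    intro b ρ c
    by_cases h : (b : ℕ) < l ∨ (b : ℕ) = l ∧ (ρ : ℕ) < r
    · obtain ⟨x, hx⟩ := (hfill b ρ c).2 h
      exact ⟨x, fun _ => hx⟩
    · have : Nonempty σ := Fintype.card_pos_iff.1 (by rw [hσ]; positivity)
      exact ⟨this.some, fun h' => absurd h' h⟩
  choose val hval using hval
  have hfull : ∀ (b : Fin k) x, ∃ c, (b : ℕ) < l → ∃ ρ, A b ρ c = some x := by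
    intro b x
    by_cases hb : (b : ℕ) < l
    · have hbij : Function.Bijective fun p : Fin k × Fin k => val b p.1 p.2 := by
        refine (Fintype.bijective_iff_injective_and_card _).2 ⟨?_, by simp [hσ]⟩
        rintro ⟨ρ, c⟩ ⟨ρ', c'⟩ he
        have h1 : val b ρ c = val b ρ' c' := he
        have := hblock _ _ _ _ _ _ (hval b ρ c (Or.inl hb)) (h1 ▸ hval b ρ' c' (Or.inl hb))
        exact Prod.ext this.1 this.2
      obtain ⟨⟨ρ, c⟩, hx⟩ := hbij.2 x
      exact ⟨c, fun _ => ⟨ρ, (hval b ρ c (Or.inl hb)).trans (congrArg some hx)⟩⟩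
    · exact ⟨⟨0, hk⟩, fun h => absurd h hb⟩
  choose F hFA using hfull
  have hAF : ∀ (b : Fin k) ρ c x, (b : ℕ) < l → A b ρ c = some x → F b x = c := by
    intro b ρ c x hb hx
    obtain ⟨ρ', h'⟩ := hFA b x hb
    exact (hblock _ _ _ _ _ _ h' hx).2
  have hF : ∀ b : Fin k, (b : ℕ) < l → ∀ c, #{x | F b x = c} = k := by
    intro b hb c
    have hkk : #(univ : Finset (Fin k)) = k := by simp
    refine Eq.trans ?_ hkk
    symm
    refine card_bij (fun ρ _ => val b ρ c) ?_ ?_ ?_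
    · intro ρ _
      simp only [mem_filter, mem_univ, true_and]
      exact hAF _ _ _ _ hb (hval b ρ c (Or.inl hb))
    · intro ρ _ ρ' _ he
      exact (hblock _ _ _ _ _ _ (hval b ρ c (Or.inl hb)) (he ▸ hval b ρ' c (Or.inl hb))).1
    · intro x hx
      simp only [mem_filter, mem_univ, true_and] at hx
      obtain ⟨ρ, h'⟩ := hFA b x hb
      rw [hx, hval b ρ c (Or.inl hb)] at h'
      exact ⟨ρ, mem_univ _, Option.some_injective _ h'⟩
  have hinj : ∀ b b' : Fin k, (b : ℕ) < l → (b' : ℕ) < l → ∀ x, F b x = F b' x → b = b' := by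
    intro b b' hb hb' x he
    obtain ⟨ρ, h1⟩ := hFA b x hb
    obtain ⟨ρ', h2⟩ := hFA b' x hb'
    exact (hcol _ _ _ _ _ _ h1 (he ▸ h2)).1
  let β : Fin k := ⟨l, hl⟩
  have hvalβ : ∀ (ρ : Fin k) c, (ρ : ℕ) < r → A β ρ c = some (val β ρ c) :=
    fun ρ c hρ => hval β ρ c (Or.inr ⟨rfl, hρ⟩)
  have hcardr : #({ρ : Fin k | (ρ : ℕ) < r} : Finset (Fin k)) = r := by
    rw [Fin.card_filter_val_lt]; omega
  have hltr : ∀ ρ c x, A β ρ c = some x → (ρ : ℕ) < r := by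
    intro ρ c x hx
    have := (hfill β ρ c).1 ⟨x, hx⟩
    simpa [β] using this
  let present : σ → Prop := fun x => ∃ ρ c, A β ρ c = some x
  let V : Finset σ := {x | ¬ present x}
  have hpresent : #{x | present x} = r * k := by
    have : r * k = #(({ρ : Fin k | (ρ : ℕ) < r} : Finset (Fin k)) ×ˢ (univ : Finset (Fin k))) := by
      rw [card_product, hcardr]; simp
    rw [this]
    symm
    refine card_bij (fun p _ => val β p.1 p.2) ?_ ?_ ?_
    · rintro ⟨ρ, c⟩ hp
      simp only [mem_product, mem_filter, mem_univ, true_and, and_true] at hp ⊢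
      exact ⟨_, _, hvalβ ρ c hp⟩
    · rintro ⟨ρ, c⟩ hp ⟨ρ', c'⟩ hp' he
      simp only [mem_product, mem_filter, mem_univ, true_and, and_true] at hp hp' he
      have := hblock _ _ _ _ _ _ (hvalβ ρ c hp) (he ▸ hvalβ ρ' c' hp')
      exact Prod.ext this.1 this.2
    · intro x hx
      simp only [mem_filter, mem_univ, true_and] at hx
      obtain ⟨ρ, c, hx⟩ := hx
      have hρ := hltr _ _ _ hx
      refine ⟨(ρ, c), by simpa using hρ, ?_⟩
      rw [hvalβ ρ c hρ] at hx
      exact Option.some_injective _ hx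
  have hcolcard : ∀ (P : Finset σ) c, (∀ x, x ∈ P ↔ ∃ ρ, A β ρ c = some x) → #P = r := by
    intro P c hP
    rw [← hcardr]
    symm
    refine card_bij (fun ρ _ => val β ρ c) ?_ ?_ ?_
    · intro ρ hρ
      simp only [mem_filter, mem_univ, true_and] at hρ
      exact (hP _).2 ⟨ρ, hvalβ ρ c hρ⟩
    · intro ρ hρ ρ' hρ' he
      simp only [mem_filter, mem_univ, true_and] at hρ hρ'
      exact (hcol _ _ _ _ _ _ (hvalβ ρ c hρ) (he ▸ hvalβ ρ' c hρ')).2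
    · intro x hx
      obtain ⟨ρ, hx⟩ := (hP x).1 hx
      have hρ := hltr _ _ _ hx
      refine ⟨ρ, by simpa using hρ, ?_⟩
      rw [hvalβ ρ c hρ] at hx
      exact Option.some_injective _ hx
  have hV : #V = k * (k - r) := by
    have := card_filter_add_card_filter_not (s := (univ : Finset σ)) present
    rw [hpresent, card_univ, hσ] at this
    have h2 : #V = #{x | ¬ present x} := rfl
    rw [Nat.mul_sub, mul_comm k r]
    omega
  let used : σ → Fin k → Prop := fun x c => ∃ b : Fin k, (b : ℕ) < l ∧ F b x = c
  have cnt1 : ∀ c, #{x | used x c} = k * l := card_used_symbols hl.le F hF hinj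
  have cnt2 : ∀ x, #{c | used x c} = l := card_used_columns hl.le F hinj
  have hdx : ∀ x, #{c | ¬ used x c} = k - l := by
    intro x
    have := card_filter_add_card_filter_not (s := (univ : Finset (Fin k))) (fun c => used x c)
    rw [cnt2, card_univ, Fintype.card_fin] at this
    omega
  have hnotused : ∀ ρ c x, A β ρ c = some x → ¬ used x c := by
    rintro ρ c x hx ⟨b, hb, hbx⟩
    obtain ⟨ρ', h'⟩ := hFA b x hb
    have := (hcol _ _ _ _ _ _ (hbx ▸ h') hx).1
    rw [this] at hb
    exact lt_irrefl _ hb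
  -- Column `c` is available to `k * (k - l)` symbols, among them the `r` symbols already placed
  -- there in band `l`, which are not in `V`.
  have hdc : ∀ c, #{x ∈ V | ¬ used x c} + r ≤ k * (k - l) := by
    intro c
    have h1 : #{x | ¬ used x c} = k * (k - l) := by
      have := card_filter_add_card_filter_not (s := (univ : Finset σ)) (fun x => used x c)
      rw [cnt1, card_univ, hσ] at this
      rw [Nat.mul_sub]
      omega
    rw [← h1, ← hcolcard {x | ∃ ρ, A β ρ c = some x} c (by simp), ← card_union_of_disjoint]
    · refine card_le_card fun x hx => ?_
      simp only [mem_union, mem_filter, mem_univ, true_and] at hx ⊢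
      rcases hx with hx | ⟨ρ, hx⟩
      · exact hx.2
      · exact hnotused _ _ _ hx
    · rw [disjoint_left]
      intro x hx hx'
      simp only [V, mem_filter, mem_univ, true_and] at hx hx'
      obtain ⟨ρ, hx'⟩ := hx'
      exact hx.1 ⟨ρ, c, hx'⟩
  obtain ⟨f, hfN, hfcard⟩ := exists_balanced_of_hall V (fun x => ({c | ¬ used x c} : Finset (Fin k)))
    (k - r) (by simpa using hV) (by
      intro X hX
      set N := X.biUnion fun x => ({c | ¬ used x c} : Finset (Fin k)) with hN
      have hXN : ∀ x ∈ X, ({c | ¬ used x c} : Finset (Fin k)) ⊆ N := fun x hx =>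
        subset_biUnion_of_mem (fun x => ({c | ¬ used x c} : Finset (Fin k))) hx
      rcases hlr with hlr | hlr
      -- Double counting of the pairs in `X × N`: symbols have degree `k - l`, columns at most `k *
      -- (k - l) - r`, and `r * (k - l) ≤ r` bounds the latter by `(k - r) * (k - l)`.
      · have h1 : #X * (k - l) ≤ #N * (k * (k - l) - r) := by
          refine card_mul_le_card_mul (fun x c => ¬ used x c) ?_ ?_
          · intro x hx
            rw [← hdx x]
            refine card_le_card fun c hc => ?_
            have hc' := hXN x hx hc
            simp only [mem_filter, mem_univ, true_and] at hc
            simp only [bipartiteAbove, mem_filter]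
            exact ⟨hc', hc⟩
          · intro c _
            have := hdc c
            refine le_trans (card_le_card ?_) (Nat.le_sub_of_add_le this)
            intro x hx
            simp only [bipartiteBelow, mem_filter] at hx ⊢
            exact ⟨hX hx.1, hx.2⟩
        have h2 : k * (k - l) - r ≤ (k - r) * (k - l) := by
          rw [Nat.sub_mul]; omega
        have h3 : #X * (k - l) ≤ #N * (k - r) * (k - l) :=
          h1.trans (by rw [mul_assoc]; exact Nat.mul_le_mul_left _ h2)
        exact Nat.le_of_mul_le_mul_right h3 (by omega)
      · rcases X.eq_empty_or_nonempty with rfl | ⟨x, hx⟩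
        · simp
        by_cases hNu : N = univ
        · rw [hNu, card_univ, Fintype.card_fin, ← hV]
          exact card_le_card hX
        · obtain ⟨c, hc⟩ : ∃ c, c ∉ N := by
            by_contra! h
            exact hNu (eq_univ_iff_forall.2 h)
          have h1 : #X ≤ k * l := by
            rw [← cnt1 c]
            refine card_le_card fun y hy => ?_
            simp only [mem_filter, mem_univ, true_and]
            by_contra h
            exact hc (hXN y hy (by simpa using h))
          have h2 : k - l ≤ #N := by
            rw [← hdx x]
            exact card_le_card (hXN x hx)
          calc #X ≤ k * l := h1
            _ = l * k := mul_comm _ _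
            _ ≤ (k - r) * (k - l) := hlr
            _ ≤ (k - r) * #N := Nat.mul_le_mul_left _ h2
            _ = #N * (k - r) := mul_comm _ _)
  have hg : ∀ x, ∃ c, (∃ ρ, A β ρ c = some x) ∨ ∃ h : x ∈ V, f ⟨x, h⟩ = c := by
    intro x
    by_cases hx : x ∈ V
    · exact ⟨f ⟨x, hx⟩, Or.inr ⟨hx, rfl⟩⟩
    · simp only [V, mem_filter, mem_univ, true_and, not_not] at hx
      obtain ⟨ρ, c, hx⟩ := hx
      exact ⟨c, Or.inl ⟨ρ, hx⟩⟩
  choose g hg using hg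
  have hgA : ∀ ρ c x, A β ρ c = some x → g x = c := by
    intro ρ c x hx
    rcases hg x with ⟨ρ', h⟩ | ⟨h, -⟩
    · exact (hblock _ _ _ _ _ _ h hx).2
    · simp only [V, mem_filter, mem_univ, true_and] at h
      exact absurd ⟨ρ, c, hx⟩ h
  have hgV : ∀ x (h : x ∈ V), g x = f ⟨x, h⟩ := by
    intro x hx
    rcases hg x with ⟨ρ', h⟩ | ⟨h, h'⟩
    · simp only [V, mem_filter, mem_univ, true_and] at hx
      exact absurd ⟨_, _, h⟩ hx
    · exact h'.symm
  have hgused : ∀ x, ¬ used x (g x) := by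
    intro x
    rcases hg x with ⟨ρ, h⟩ | ⟨h, h'⟩
    · exact hnotused _ _ _ h
    · have := hfN ⟨x, h⟩
      rw [h'] at this
      simpa using this
  have hgcard : ∀ c, #{x | g x = c} = k := by
    intro c
    rw [← card_filter_add_card_filter_not (s := ({x | g x = c} : Finset σ)) (fun x => x ∈ V)]
    rw [hcolcard (({x | g x = c} : Finset σ).filter fun x => ¬ x ∈ V) c]
    · have : #(({x | g x = c} : Finset σ).filter fun x => x ∈ V) = k - r := by
        rw [← hfcard c]
        symm
        refine card_bij (fun x _ => (x : σ)) ?_ ?_ ?_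
        · intro x hx
          simp only [mem_filter, mem_univ, true_and] at hx ⊢
          exact ⟨(hgV x x.2).trans hx, x.2⟩
        · intro x _ y _ h
          exact Subtype.ext h
        · intro x hx
          simp only [mem_filter, mem_univ, true_and] at hx
          exact ⟨⟨x, hx.2⟩, by simp only [mem_filter, mem_univ, true_and]; rw [← hgV]; exact hx.1,
            rfl⟩
      rw [this]
      omega
    · intro x
      simp only [mem_filter, mem_univ, true_and]
      constructor
      · rintro ⟨h1, h2⟩
        rcases hg x with ⟨ρ, h⟩ | ⟨h, -⟩
        · exact ⟨ρ, h1 ▸ h⟩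
        · exact absurd h h2
      · rintro ⟨ρ, h⟩
        refine ⟨hgA _ _ _ h, ?_⟩
        simp only [V, mem_filter, mem_univ, true_and, not_not]
        exact ⟨_, _, h⟩
  -- With `g` in band `l`, the first `l + 1` bands are settled and the unrestricted extension
  -- handles the rest.
  obtain ⟨G, hG1, hG2, hG3⟩ := exists_column_assignment_extension (l := l + 1) hσ hk (by omega)
    (fun b x => if b = β then g x else F b x) (by
      intro b hb c
      by_cases hbβ : b = β
      · simp only [hbβ, if_true]
        exact hgcard c
      · simp only [hbβ, if_false]
        have : (b : ℕ) ≠ l := fun h => hbβ (Fin.ext h)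
        exact hF b (by omega) c) (by
      intro b b' hb hb' x he
      have hlt : ∀ b : Fin k, (b : ℕ) < l + 1 → b ≠ β → (b : ℕ) < l := by
        intro b hb h
        have : (b : ℕ) ≠ l := fun h' => h (Fin.ext h')
        omega
      by_cases h : b = β <;> by_cases h' : b' = β
      · rw [h, h']
      · simp only [h, h', if_true, if_false] at he
        exact absurd ⟨b', hlt _ hb' h', he.symm⟩ (hgused x)
      · simp only [h, h', if_true, if_false] at he
        exact absurd ⟨b, hlt _ hb h, he⟩ (hgused x)
      · simp only [h, h', if_false] at he
        exact hinj b b' (hlt _ hb h) (hlt _ hb' h') x he)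
  refine ⟨G, hG2, hG3, ?_⟩
  intro b ρ c x hx
  have hb := (hfill b ρ c).1 ⟨x, hx⟩
  rw [hG1 b (by omega)]
  by_cases h : b = β
  · subst h
    simp only [if_true]
    exact hgA _ _ _ hx
  · have : (b : ℕ) ≠ l := fun h' => h (Fin.ext h')
    simp only [h, if_false]
    exact hAF _ _ _ _ (by omega) hx

/-! ### Translation between matrices and arrays -/

/-- Rows (or columns) of an `n × n` matrix with `n = k ^ 2` as pairs consisting of a band
(or stack) and a position in it. -/
def blockEquiv {k n : ℕ} (hn : n = k ^ 2) : Fin n ≃ Fin k × Fin k :=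
  (finCongr (hn.trans (sq k))).trans finProdFinEquiv.symm

theorem blockEquiv_fst {k n : ℕ} (hn : n = k ^ 2) (i : Fin n) :
    ((blockEquiv hn i).1 : ℕ) = i / k := rfl

theorem blockEquiv_snd {k n : ℕ} (hn : n = k ^ 2) (i : Fin n) :
    ((blockEquiv hn i).2 : ℕ) = i % k := rfl

theorem lt_iff_blockEquiv {k n l r : ℕ} (hn : n = k ^ 2) (hr : r < k) (i : Fin n) :
    (i : ℕ) < l * k + r ↔ (((blockEquiv hn i).1 : ℕ) < l ∨
      ((blockEquiv hn i).1 : ℕ) = l ∧ ((blockEquiv hn i).2 : ℕ) < r) := by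
  rw [blockEquiv_fst, blockEquiv_snd]
  have h1 := Nat.div_add_mod (i : ℕ) k
  have h2 := Nat.mod_lt (i : ℕ) (by omega : 0 < k)
  rcases lt_trichotomy ((i : ℕ) / k) l with h | h | h
  · have : k * ((i : ℕ) / k + 1) ≤ k * l := Nat.mul_le_mul_left _ h
    rw [mul_comm l]
    rw [mul_add] at this
    simp only [h, true_or, iff_true]
    omega
  · subst h
    simp only [lt_irrefl, false_or, true_and]
    rw [mul_comm]
    omega
  · have : k * (l + 1) ≤ k * ((i : ℕ) / k) := Nat.mul_le_mul_left _ h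
    rw [mul_comm l]
    rw [mul_add] at this
    constructor <;> intro h' <;> omega

theorem isPartialSudokuSquare_iff {k n : ℕ} (hn : n = k ^ 2)
    (A : Fin k → Fin k → Fin k → Fin k → Option (Fin n)) :
    IsPartialSudokuSquare k (fun i j => A (blockEquiv hn i).1 (blockEquiv hn i).2
      (blockEquiv hn j).1 (blockEquiv hn j).2 : PartialMatrix n) ↔ IsSudokuArray A := by
  constructor
  · rintro ⟨hrow, hcol, hblock⟩
    refine ⟨?_, ?_, ?_⟩
    · intro b ρ s c s' c' x h1 h2
      have := hrow x ((blockEquiv hn).symm (b, ρ)) ((blockEquiv hn).symm (s, c))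
        ((blockEquiv hn).symm (s', c')) (by simpa using h1) (by simpa using h2)
      simpa using this
    · intro b ρ b' ρ' s c x h1 h2
      have := hcol x ((blockEquiv hn).symm (b, ρ)) ((blockEquiv hn).symm (b', ρ'))
        ((blockEquiv hn).symm (s, c)) (by simpa using h1) (by simpa using h2)
      simpa using this
    · intro b ρ ρ' s c c' x h1 h2
      have := hblock x ((blockEquiv hn).symm (b, ρ), (blockEquiv hn).symm (s, c))
        ((blockEquiv hn).symm (b, ρ'), (blockEquiv hn).symm (s, c'))
        ⟨by simp only [← blockEquiv_fst hn, Equiv.apply_symm_apply],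
          by simp only [← blockEquiv_fst hn, Equiv.apply_symm_apply]⟩
        (by simpa using h1) (by simpa using h2)
      simpa using this
  · intro hA
    refine ⟨?_, ?_, ?_⟩
    · intro x i j j' h1 h2
      have := hA.row _ _ _ _ _ _ x h1 h2
      exact (blockEquiv hn).injective (Prod.ext this.1 this.2)
    · intro x i i' j h1 h2
      have := hA.column _ _ _ _ _ _ x h1 h2
      exact (blockEquiv hn).injective (Prod.ext this.1 this.2)
    · rintro x ⟨i, j⟩ ⟨i', j'⟩ ⟨hi, hj⟩ h1 h2
      simp only [← blockEquiv_fst hn] at hi hj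
      rw [← Fin.ext_iff] at hi hj
      simp only at h1 h2
      rw [← hi, ← hj] at h2
      have := hA.block _ _ _ _ _ _ x h1 h2
      rw [Prod.mk.injEq]
      exact ⟨(blockEquiv hn).injective (Prod.ext hi this.1),
        (blockEquiv hn).injective (Prod.ext hj this.2)⟩

theorem card_symbols {k n : ℕ} (hn : n = k ^ 2) : Fintype.card (Fin n) = k * k := by
  rw [Fintype.card_fin, hn, sq]

/-- Columns are chosen stack by stack, then rows band by band. Since `l < k`, the inequality `r * (k
- l) ≤ r` expresses `r = 0` or `l = k - 1` in the form used for double counting. -/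
theorem isCompletable_of_le {k n m l r : ℕ} (hn : n = k ^ 2) (hm : m = l * k + r) (hl : l < k)
    (hr : r < k) (hlr : r * (k - l) ≤ r ∨ l * k ≤ (k - r) * (k - l)) (R : PartialMatrix n)
    (hR : IsSudokuRectangle k m R) : IsCompletable k R := by
  let e := blockEquiv hn
  let A : Fin k → Fin k → Fin k → Fin k → Option (Fin n) :=
    fun b ρ s c => R (e.symm (b, ρ)) (e.symm (s, c))
  have hRA : R = fun i j => A (e i).1 (e i).2 (e j).1 (e j).2 := by
    funext i j
    simp [A]
  have hA : IsSudokuArray A := (isPartialSudokuSquare_iff hn A).1 (hRA ▸ hR.isPartial)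
  have hfill : ∀ b ρ s c, (∃ x, A b ρ s c = some x) ↔
      ((b : ℕ) < l ∨ (b : ℕ) = l ∧ (ρ : ℕ) < r) := by
    intro b ρ s c
    have h1 := lt_iff_blockEquiv (l := l) hn hr (e.symm (b, ρ))
    rw [← hm] at h1
    simp only [e, Equiv.apply_symm_apply] at h1
    rw [← h1, ← Option.ne_none_iff_exists']
    constructor
    · intro h
      by_contra h'
      exact h (hR.empty_of_le _ _ (not_lt.1 h'))
    · exact hR.filled_of_lt _ _
  choose F hF hinj hAF using fun s => exists_column_assignment (card_symbols hn) hl hr hlr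
    (fun b ρ c => A b ρ s c) (fun b ρ c => hfill b ρ s c)
    (fun b ρ b' ρ' c x => hA.column b ρ b' ρ' s c x)
    (fun b ρ ρ' c c' x => hA.block b ρ ρ' s c c' x)
  obtain ⟨S, hS, -, hext⟩ := hA.exists_completion (card_symbols hn)
    (fun b => if (b : ℕ) < l then k else if (b : ℕ) = l then r else 0)
    (fun b => by split_ifs <;> omega)
    (fun b ρ s c => by
      rw [hfill]
      have := ρ.2
      split_ifs <;> omega)
    (fun b s => F s b) (fun b s => hF s b) hinj (fun b ρ s => hAF s b ρ)
  refine ⟨fun i j => S (e i).1 (e i).2 (e j).1 (e j).2,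
    (isPartialSudokuSquare_iff hn fun b ρ s c => some (S b ρ s c)).2 hS, ?_⟩
  intro i j hij
  obtain ⟨x, hx⟩ := Option.ne_none_iff_exists'.1 hij
  rw [hx]
  refine congrArg some (hext _ _ _ _ x ?_).symm
  rw [← hx, hRA]

/-! ### Necessity: a rectangle without completion -/

/-- When symbols are dealt cyclically modulo `M`, this ensures that a column receiving at most `M`
consecutive positions gets no symbol twice. -/
theorem Nat.eq_of_mod_eq_of_mem_Ico {s len M p p' : ℕ} (hlen : len ≤ M) (hp : s ≤ p)
    (hp' : p < s + len) (hq : s ≤ p') (hq' : p' < s + len) (h : p % M = p' % M) : p = p' := by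
  rcases le_total p p' with hle | hle
  · have := Nat.eq_zero_of_dvd_of_lt ((Nat.modEq_iff_dvd' hle).1 h) (by omega)
    omega
  · have := Nat.eq_zero_of_dvd_of_lt ((Nat.modEq_iff_dvd' hle).1 h.symm) (by omega)
    omega

open Finset in
open scoped Classical in
/-- A relation between `M = l * k + a` symbols and `k = l + d` columns with degrees `d` of the
symbols, `d * k` of the first `l` columns and `a` of the others, obtained by dealing out the
symbols cyclically to the columns. -/
theorem exists_cyclic_relation {k l d a M : ℕ} (hk : k = l + d) (ha : 1 ≤ a) (hd : 2 ≤ d)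
    (hM : M = l * k + a) (hdk : d * k ≤ M) :
    ∃ J : Fin M → Fin k → Prop, (∀ c : Fin k, (c : ℕ) < l → #{y | J y c} = d * k) ∧
      (∀ c : Fin k, l ≤ (c : ℕ) → #{y | J y c} = a) ∧ (∀ y, #{c | J y c} = d) ∧
      ∀ y : Fin M, (y : ℕ) ≤ a → ∃ c : Fin k, l ≤ (c : ℕ) ∧ J y c := by
  -- Position `p < d * M` carries symbol `p % M`. The last `d` columns take the first `d` intervals,
  -- of length `a`; then the first `l` columns take intervals of length `d * k`. Serving the last
  -- columns first makes them meet all symbols `0, …, a`.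
  let col : ℕ → ℕ := fun p => if p < d * a then l + p / a else (p - d * a) / (d * k)
  let start : ℕ → ℕ := fun c => if c < l then d * a + c * (d * k) else (c - l) * a
  let len : ℕ → ℕ := fun c => if c < l then d * k else a
  have hM0 : 0 < M := by omega
  have hdk0 : 0 < d * k := Nat.mul_pos (by omega) (by omega)
  have hdM : d * M = d * a + l * (d * k) := by rw [hM]; ring
  have hlen : ∀ c, len c ≤ M := by
    intro c
    simp only [len]
    split_ifs
    · exact hdk
    · omega
  have hend : ∀ c < k, start c + len c ≤ d * M := by
    intro c hc
    simp only [start, len]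
    split_ifs with h
    · have : (c + 1) * (d * k) ≤ l * (d * k) := Nat.mul_le_mul_right _ h
      rw [add_mul, one_mul] at this
      omega
    · have : (c - l + 1) * a ≤ d * a := Nat.mul_le_mul_right _ (by omega)
      rw [add_mul, one_mul] at this
      omega
  have hcollt : ∀ p < d * M, col p < k := by
    intro p hp
    simp only [col]
    split_ifs with h
    · have : p / a < d := (Nat.div_lt_iff_lt_mul (by omega)).2 h
      omega
    · have : (p - d * a) / (d * k) < l := (Nat.div_lt_iff_lt_mul hdk0).2 (by omega)
      omega
  have hcol : ∀ p < d * M, start (col p) ≤ p ∧ p < start (col p) + len (col p) := by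
    intro p hp
    by_cases h : p < d * a
    · simp only [col, start, len, h, if_true, Nat.not_lt.2 (Nat.le_add_right l _), if_false,
        Nat.add_sub_cancel_left]
      have h1 := Nat.div_add_mod p a
      have h2 := Nat.mod_lt p (by omega : 0 < a)
      rw [mul_comm] at h1
      omega
    · have h3 : (p - d * a) / (d * k) < l := (Nat.div_lt_iff_lt_mul hdk0).2 (by omega)
      simp only [col, start, len, h, if_false, h3, if_true]
      have h1 := Nat.div_add_mod (p - d * a) (d * k)
      have h2 := Nat.mod_lt (p - d * a) hdk0
      rw [mul_comm] at h1
      omega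
  have hcol' : ∀ c < k, ∀ p, start c ≤ p → p < start c + len c → col p = c := by
    intro c hc p h1 h2
    by_cases h : c < l
    · simp only [start, len, h, if_true] at h1 h2
      have h3 : ¬ p < d * a := by omega
      simp only [col, h3, if_false]
      exact Nat.div_eq_of_lt_le (by omega) (by rw [Nat.succ_mul]; omega)
    · simp only [start, len, h, if_false] at h1 h2
      have h4 : (c - l + 1) * a ≤ d * a := Nat.mul_le_mul_right _ (by omega)
      rw [add_mul, one_mul] at h4
      have h3 : p < d * a := by omega
      simp only [col, h3, if_true]
      have : p / a = c - l := Nat.div_eq_of_lt_le (by omega) (by rw [Nat.succ_mul]; omega)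
      omega
  let J : Fin M → Fin k → Prop := fun y c =>
    ∃ p, start c ≤ p ∧ p < start c + len c ∧ p % M = y
  have hJ : ∀ p (hp : p < d * M) (y : Fin M), p % M = y → J y ⟨col p, hcollt p hp⟩ :=
    fun p hp y hy => ⟨p, (hcol p hp).1, (hcol p hp).2, hy⟩
  have hcard : ∀ c : Fin k, #{y | J y c} = len c := by
    intro c
    have : #(Ico (start c) (start c + len c)) = len c := by simp
    rw [← this]
    symm
    refine card_bij (fun p _ => ⟨p % M, Nat.mod_lt _ hM0⟩) ?_ ?_ ?_
    · intro p hp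
      rw [mem_Ico] at hp
      simp only [mem_filter, mem_univ, true_and]
      exact ⟨p, hp.1, hp.2, rfl⟩
    · intro p hp p' hp' he
      rw [mem_Ico] at hp hp'
      exact Nat.eq_of_mod_eq_of_mem_Ico (hlen c) hp.1 hp.2 hp'.1 hp'.2 (Fin.mk.inj he)
    · intro y hy
      simp only [mem_filter, mem_univ, true_and] at hy
      obtain ⟨p, h1, h2, h3⟩ := hy
      exact ⟨p, mem_Ico.2 ⟨h1, h2⟩, Fin.ext h3⟩
  have hpos : ∀ (y : Fin M) t, t < d → (y : ℕ) + t * M < d * M := by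
    intro y t ht
    have : (t + 1) * M ≤ d * M := Nat.mul_le_mul_right _ ht
    rw [add_mul, one_mul] at this
    have := y.2
    omega
  have hmod : ∀ (y : Fin M) t, ((y : ℕ) + t * M) % M = y := by
    intro y t
    rw [Nat.add_mul_mod_self_right, Nat.mod_eq_of_lt y.2]
  refine ⟨J, ?_, ?_, ?_, ?_⟩
  · intro c hc
    rw [hcard]
    exact if_pos hc
  · intro c hc
    rw [hcard]
    exact if_neg (by omega)
  · intro y
    refine Eq.trans ?_ (card_range d)
    symm
    -- Symbol `y` sits at the `d` positions `y + t * M`, which fall into distinct columns.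
    refine card_bij (fun t ht => ⟨col (y + t * M), hcollt _ (hpos y t (mem_range.1 ht))⟩) ?_ ?_ ?_
    · intro t ht
      simp only [mem_filter, mem_univ, true_and]
      exact hJ _ (hpos y t (mem_range.1 ht)) _ (hmod y t)
    · intro t ht t' ht' he
      have he' := Fin.mk.inj he
      have h1 := hcol _ (hpos y t (mem_range.1 ht))
      have h2 := hcol _ (hpos y t' (mem_range.1 ht'))
      rw [← he'] at h2
      have h3 := Nat.eq_of_mod_eq_of_mem_Ico (hlen _) h1.1 h1.2 h2.1 h2.2
        ((hmod y t).trans (hmod y t').symm)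
      exact Nat.eq_of_mul_eq_mul_right hM0 (by omega)
    · intro c hc
      simp only [mem_filter, mem_univ, true_and] at hc
      obtain ⟨p, h1, h2, h3⟩ := hc
      have hp : p < d * M := h2.trans_le (hend c c.2)
      have h4 : (y : ℕ) + p / M * M = p := by
        have := Nat.div_add_mod p M
        rw [mul_comm] at this
        omega
      refine ⟨p / M, mem_range.2 ((Nat.div_lt_iff_lt_mul hM0).2 hp), Fin.ext ?_⟩
      simp only [h4]
      exact hcol' c c.2 p h1 h2
  · intro y hy
    have h1 : (y : ℕ) < d * M := by simpa using hpos y 0 (by omega)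
    refine ⟨_, ?_, hJ y h1 y (Nat.mod_eq_of_lt y.2)⟩
    have h2 : (y : ℕ) < d * a := by
      have : 2 * a ≤ d * a := Nat.mul_le_mul_right _ hd
      omega
    simp only [col, h2, if_true]
    exact Nat.le_add_right _ _

open Finset in
open scoped Classical in
/-- A relation as in `exists_cyclic_relation` together with disjoint sets of `r` symbols related
to each of the columns. -/
theorem exists_cyclic_relation_with_transversal {k l d r q : ℕ} (hkl : k = l + d)
    (hkr : k = r + q) (hl : 1 ≤ l) (hd : 2 ≤ d) (hr : 1 ≤ r) (hq : 1 ≤ q) (h : q * d < l * k) :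
    ∃ (M : ℕ) (J : Fin M → Fin k → Prop) (T : Fin k × Fin r → Fin M), M + 1 = l * k + d * r ∧
      (∀ c : Fin k, (c : ℕ) < l → #{y | J y c} = d * k) ∧
      (∀ c : Fin k, l ≤ (c : ℕ) → #{y | J y c} + 1 = d * r) ∧ (∀ y, #{c | J y c} = d) ∧
      Function.Injective T ∧ ∀ c ρ, J (T (c, ρ)) c := by
  have hdr : d * 1 ≤ d * r := Nat.mul_le_mul_left _ hr
  -- Of the `d * k` symbols needed in each of the last `d` columns, `q * d + 1` will come from `X`,
  -- leaving `d * r - 1`.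
  obtain ⟨a, ha⟩ : ∃ a, a + 1 = d * r := ⟨d * r - 1, by omega⟩
  have hlk : 1 * 1 ≤ l * k := Nat.mul_le_mul hl (by omega)
  have hdkr : d * k = d * r + q * d := by rw [hkr]; ring
  obtain ⟨J, hJ1, hJ2, hJ3, hJ4⟩ := exists_cyclic_relation (a := a) hkl (by omega) hd rfl
    (by omega : d * k ≤ l * k + a)
  have hall : ∀ A : Finset (Fin k × Fin r), #A ≤ #(A.biUnion fun p => {y | J y p.1}) := by
    intro A
    set N := A.biUnion fun p => ({y | J y p.1} : Finset (Fin (l * k + a))) with hN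
    set C := A.image Prod.fst with hC
    have hCN : ∀ c ∈ C, ∀ y, J y c → y ∈ N := by
      intro c hc y hy
      obtain ⟨p, hp, rfl⟩ := mem_image.1 hc
      exact mem_biUnion.2 ⟨p, hp, by simpa using hy⟩
    have h1 : #A ≤ #C * r := by
      have : A ⊆ C ×ˢ univ := fun p hp => mem_product.2 ⟨mem_image_of_mem _ hp, mem_univ _⟩
      simpa using card_le_card this
    refine h1.trans ?_
    have h2 : ∑ c ∈ C, #{y | J y c} ≤ #N * d := by
      have e1 : ∑ c ∈ C, #{y | J y c} = ∑ c ∈ C, #(bipartiteAbove (fun c y => J y c) N c) := by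
        refine sum_congr rfl fun c hc => ?_
        congr 1
        ext y
        simp only [bipartiteAbove, mem_filter, mem_univ, true_and]
        exact ⟨fun h => ⟨hCN c hc y h, h⟩, fun h => h.2⟩
      rw [e1, sum_card_bipartiteAbove_eq_sum_card_bipartiteBelow]
      refine sum_le_card_nsmul _ _ _ fun y _ => ?_
      rw [← hJ3 y]
      refine card_le_card fun c hc => ?_
      simp only [bipartiteBelow, mem_filter, mem_univ, true_and] at hc ⊢
      exact hc.2
    have hright : #({c : Fin k | l ≤ (c : ℕ)} : Finset (Fin k)) = d := by
      have := card_filter_add_card_filter_not (s := (univ : Finset (Fin k)))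
        (fun c => (c : ℕ) < l)
      simp only [not_lt] at this
      rw [Fin.card_filter_val_lt, card_univ, Fintype.card_fin] at this
      omega
    by_cases hleft : ∃ c ∈ C, (c : ℕ) < l
    · obtain ⟨c₀, hc₀, hlt⟩ := hleft
      -- A column before `l` has surplus `d * k - d * r = q * d ≥ d`, which offsets the deficit 1 of
      -- each of the at most `d` later columns.
      have h3 : #C * (d * r) + d ≤ ∑ c ∈ C, (#{y | J y c} + if l ≤ (c : ℕ) then 1 else 0) := by
        rw [← add_sum_erase C _ hc₀, ← card_erase_add_one hc₀, hJ1 c₀ hlt]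
        have h4 : #(C.erase c₀) * (d * r) ≤
            ∑ c ∈ C.erase c₀, (#{y | J y c} + if l ≤ (c : ℕ) then 1 else 0) := by
          refine card_nsmul_le_sum _ _ _ fun c _ => ?_
          split_ifs with hc
          · rw [hJ2 c hc]; omega
          · rw [hJ1 c (by omega)]; omega
        have h5 : 1 * d ≤ q * d := Nat.mul_le_mul_right _ hq
        rw [add_mul, one_mul]
        omega
      have h4 : ∑ c ∈ C, (if l ≤ (c : ℕ) then 1 else 0) ≤ d := by
        rw [← card_filter, ← hright]
        exact card_le_card (filter_subset_filter _ (subset_univ _))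
      rw [sum_add_distrib] at h3
      refine Nat.le_of_mul_le_mul_right (c := d) ?_ (by omega)
      rw [mul_assoc, mul_comm r]
      omega
    · push Not at hleft
      have hCsub : C ⊆ ({c : Fin k | l ≤ (c : ℕ)} : Finset (Fin k)) := fun c hc => by
        simpa using hleft c hc
      have hCd : #C ≤ d := hright ▸ card_le_card hCsub
      rcases hCd.lt_or_eq with hlt | heq
      -- Here the total deficit `#C` is less than `d`, so it is lost in rounding after division by
      -- `d`.
      · have h3 : ∑ c ∈ C, #{y | J y c} = #C * a := by
          rw [sum_congr rfl fun c hc => hJ2 c (hleft c hc)]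
          simp
        rw [h3] at h2
        by_contra! hcon
        have h4 : (#N + 1) * d ≤ #C * r * d := Nat.mul_le_mul_right _ hcon
        have h5 : #C * r * d = #C * a + #C := by
          rw [mul_assoc, mul_comm r, ← ha]; ring
        rw [add_mul, one_mul] at h4
        omega
      -- For all `d` late columns degree counting falls short by one; the `a + 1 = d * r` symbols
      -- `0, …, a` are needed instead.
      · have hCeq := eq_of_subset_of_card_le hCsub (by omega)
        rw [heq, ← ha]
        have : #(univ.map (Fin.castLEEmb (by omega : a + 1 ≤ l * k + a))) = a + 1 := by simp
        rw [← this]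
        refine card_le_card fun y hy => ?_
        obtain ⟨i, -, rfl⟩ := mem_map.1 hy
        obtain ⟨c, hc, hJc⟩ := hJ4 (Fin.castLEEmb (by omega : a + 1 ≤ l * k + a) i)
          (by simpa using Nat.lt_succ_iff.1 i.2)
        exact hCN c (by rw [hCeq]; simpa using hc) _ hJc
  obtain ⟨T, hT, hTJ⟩ := (all_card_le_biUnion_card_iff_exists_injective _).1 hall
  refine ⟨_, J, T, by omega, hJ1, fun c hc => by rw [hJ2 c hc, ha], hJ3, hT, fun c ρ => ?_⟩
  simpa using hTJ (c, ρ)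

open Finset in
open scoped Classical in
/-- Columns for the symbols in one stack such that the symbols of `X` occupy the first `l` columns
in the first `l` bands, while `r` further rows (with the symbols `ψ (c, ρ)`, `ρ < r`, in
column `c`) avoid `X`. The set `X` is too large for the remaining cells of band `l`. -/
theorem exists_obstructed_assignment {σ : Type*} [Fintype σ] {k l r : ℕ}
    (hσ : Fintype.card σ = k * k) (hl : 1 ≤ l) (hlk : l + 2 ≤ k) (hr : 1 ≤ r) (hrk : r < k)
    (h : (k - r) * (k - l) < l * k) :
    ∃ (ψ : Fin k × Fin k ≃ σ) (F : Fin k → σ → Fin k) (X : Finset σ),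
      (∀ b c, #{x | F b x = c} = k) ∧ (∀ x, Function.Injective fun b => F b x) ∧
      (∀ b a ρ : Fin k, (b : ℕ) < l → (ρ : ℕ) < r → F b (ψ (a, ρ)) ≠ a) ∧
      (∀ x ∈ X, r ≤ ((ψ.symm x).2 : ℕ)) ∧
      (∀ x ∈ X, ∀ c : Fin k, (c : ℕ) < l → ∃ b : Fin k, (b : ℕ) < l ∧ F b x = c) ∧
      (k - r) * (k - l) < #X := by
  obtain ⟨d, hkl⟩ : ∃ d, k = l + d := ⟨k - l, by omega⟩
  obtain ⟨q, hkr⟩ : ∃ q, k = r + q := ⟨k - r, by omega⟩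
  have hd : k - l = d := by omega
  have hq : k - r = q := by omega
  rw [hd, hq] at h ⊢
  obtain ⟨M, J, T, hM, hJ1, hJ2, hJ3, hT, hTJ⟩ := exists_cyclic_relation_with_transversal hkl hkr
    hl (by omega) hr (by omega) h
  have hdkr : d * k = d * r + q * d := by rw [hkr]; ring
  have hkk : k * k = l * k + d * k := by rw [← add_mul, ← hkl]
  obtain ⟨φ⟩ : Nonempty (σ ≃ Fin (q * d + 1) ⊕ Fin M) := by
    rw [← Fintype.card_eq, Fintype.card_sum, Fintype.card_fin, Fintype.card_fin, hσ]
    omega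
  -- `P x c` will mean that `x` avoids column `c` in the first `l` bands. The left summand is `X`,
  -- which avoids exactly the last `d` columns.
  let P : σ → Fin k → Prop := fun x c => Sum.elim (fun _ => l ≤ (c : ℕ)) (fun y => J y c) (φ x)
  have hPc : ∀ c, #{x | P x c} = d * k := by
    intro c
    have e1 : #{x | P x c} = #{z : Fin (q * d + 1) ⊕ Fin M |
        Sum.elim (fun _ => l ≤ (c : ℕ)) (fun y => J y c) z} := by
      refine card_bij (fun x _ => φ x) (by simp [P]) (fun x _ y _ h => φ.injective h) ?_
      intro z hz
      exact ⟨φ.symm z, by simpa [P] using hz, by simp⟩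
    have e2 : ({z : Fin (q * d + 1) ⊕ Fin M |
        Sum.elim (fun _ => l ≤ (c : ℕ)) (fun y => J y c) z} : Finset _) =
        ({z | l ≤ (c : ℕ)} : Finset (Fin (q * d + 1))).disjSum {y | J y c} := by
      ext (z | z)
      · by_cases hc : l ≤ (c : ℕ) <;> simp [hc]
      · simp
    rw [e1, e2, card_disjSum]
    by_cases hc : l ≤ (c : ℕ)
    · have := hJ2 c hc
      simp only [hc, filter_true, card_univ, Fintype.card_fin]
      omega
    · simp only [hc, filter_false, card_empty, zero_add]
      exact hJ1 c (by omega)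
  have hright : #({c : Fin k | l ≤ (c : ℕ)} : Finset (Fin k)) = d := by
    have := card_filter_add_card_filter_not (s := (univ : Finset (Fin k)))
      (fun c => (c : ℕ) < l)
    simp only [not_lt] at this
    rw [Fin.card_filter_val_lt, card_univ, Fintype.card_fin] at this
    omega
  have hPx : ∀ x, #{c | P x c} = d := by
    intro x
    rcases hx : φ x with z | z
    · simp only [P, hx, Sum.elim_inl]
      convert hright
    · simp only [P, hx, Sum.elim_inr]
      exact hJ3 z
  obtain ⟨F₀, hF1, hF2, hF3, hF4⟩ := exists_assignments_of_biregular (by omega : 0 < k) l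
    (fun x c => ¬ P x c) (by
      intro c
      have h1 : #{x | ¬ P x c} = l * k := by
        have := card_filter_add_card_filter_not (s := (univ : Finset σ)) (fun x => P x c)
        rw [hPc, card_univ, hσ] at this
        omega
      convert h1) (by
      intro x
      have h1 : #{c | ¬ P x c} = l := by
        have := card_filter_add_card_filter_not (s := (univ : Finset (Fin k))) (fun c => P x c)
        rw [hPx, card_univ, Fintype.card_fin] at this
        omega
      convert h1)
  obtain ⟨F, hFeq, hFk, hFinj⟩ := exists_column_assignment_extension hσ (by omega)
    (by omega : l ≤ k) (fun b => F₀ b) (fun b hb => hF1 b hb)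
    (fun b b' hb hb' x he => Fin.ext (hF3 b hb b' hb' x he))
  -- Rows below `r` hold the transversal `T`; the remaining symbols, including `X`, are placed
  -- arbitrarily. The `else` value is never imposed.
  have hex : ∃ ψ : Fin k × Fin k ≃ (univ : Finset σ), ∀ p ∈ {p : Fin k × Fin k | (p.2 : ℕ) < r},
      (ψ p : σ) = if hp : (p.2 : ℕ) < r then φ.symm (Sum.inr (T (p.1, ⟨p.2, hp⟩)))
        else φ.symm (Sum.inl 0) := by
    refine Set.MapsTo.exists_equiv_extend_of_card_eq (by simp [hσ]) (fun _ _ => by simp) ?_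
    rintro ⟨c, ρ⟩ hp ⟨c', ρ'⟩ hp' he
    simp only [Set.mem_ofPred_eq] at hp hp'
    simp only [hp, hp', dif_pos] at he
    have := hT (Sum.inr_injective (φ.symm.injective he))
    simp only [Prod.mk.injEq, Fin.mk.injEq] at this
    exact Prod.ext this.1 (Fin.ext this.2)
  obtain ⟨ψ₀, hψ₀⟩ := hex
  let ψ : Fin k × Fin k ≃ σ := ψ₀.trans (Equiv.subtypeUnivEquiv (by simp))
  have hψ : ∀ c (ρ : Fin k) (hρ : (ρ : ℕ) < r), φ (ψ (c, ρ)) = Sum.inr (T (c, ⟨ρ, hρ⟩)) := by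
    intro c ρ hρ
    have h1 := hψ₀ (c, ρ) hρ
    simp only [hρ, dif_pos] at h1
    have h2 : ψ (c, ρ) = ψ₀ (c, ρ) := rfl
    rw [h2, h1, Equiv.apply_symm_apply]
  refine ⟨ψ, F, univ.map (Function.Embedding.inl.trans φ.symm.toEmbedding), hFk, hFinj, ?_, ?_, ?_,
    by simp⟩
  · intro b a ρ hb hρ he
    have h1 := hF2 b hb (ψ (a, ρ))
    have h2 : F₀ b (ψ (a, ρ)) = a := (congrFun (hFeq b hb) _).symm.trans he
    rw [h2] at h1
    apply h1
    simp only [P, hψ a ρ hρ, Sum.elim_inr]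
    exact hTJ _ _
  · intro x hx
    obtain ⟨z, -, rfl⟩ := mem_map.1 hx
    by_contra! hcon
    have h1 := hψ (ψ.symm (φ.symm (Sum.inl z))).1 _ hcon
    simp at h1
  · intro x hx c hc
    obtain ⟨z, -, rfl⟩ := mem_map.1 hx
    obtain ⟨i, hi, he⟩ := hF4 (φ.symm (Sum.inl z)) c (by simpa [P] using hc)
    have hi' : i < k := by omega
    refine ⟨⟨i, hi'⟩, hi, ?_⟩
    rw [hFeq _ hi]
    exact he

open Finset in
open scoped Classical in
/-- An array of `l` bands and `r` further rows without a completion. -/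
theorem exists_array_without_completion {σ : Type*} [Fintype σ] {k l r : ℕ}
    (hσ : Fintype.card σ = k * k) (hl : 1 ≤ l) (hlk : l + 2 ≤ k) (hr : 1 ≤ r) (hrk : r < k)
    (h : (k - r) * (k - l) < l * k) :
    ∃ A : Fin k → Fin k → Fin k → Fin k → Option σ, IsSudokuArray A ∧
      (∀ b ρ s c, A b ρ s c ≠ none ↔ ((b : ℕ) < l ∨ (b : ℕ) = l ∧ (ρ : ℕ) < r)) ∧
      ∀ S : Fin k → Fin k → Fin k → Fin k → σ, IsSudokuArray (fun b ρ s c => some (S b ρ s c)) →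
        ¬ ∀ b ρ s c x, A b ρ s c = some x → S b ρ s c = x := by
  obtain ⟨ψ, F, X, hFk, hFinj, hψ, hXr, hXl, hXcard⟩ :=
    exists_obstructed_assignment hσ hl hlk hr hrk h
  have : NeZero k := ⟨by omega⟩
  -- Stack `s` is stack `0` with the symbols relabelled by a cyclic shift of the second coordinate
  -- of `ψ`. Thus a row `ψ (c, ρ + s)`, taken over all `s` and `c`, contains every symbol once, and
  -- the avoidance property survives in every stack.
  let shift : Fin k → σ ≃ σ := fun s =>
    ψ.symm.trans (((Equiv.refl (Fin k)).prodCongr (Equiv.addRight s).symm).trans ψ)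
  have hshift : ∀ s c ρ, shift s (ψ (c, ρ + s)) = ψ (c, ρ) := by
    intro s c ρ
    simp [shift]
  have hshift0 : ∀ x, shift 0 x = x := by
    intro x
    simp [shift, Prod.map]
  -- The empty array is completed along the shifted assignments; only the first `l` bands of `S` are
  -- kept.
  obtain ⟨S, hS, hSF, -⟩ := IsSudokuArray.exists_completion (σ := σ) (k := k)
    (A := fun _ _ _ _ => none) ⟨by simp, by simp, by simp⟩ hσ (fun _ => 0) (by simp) (by simp)
    (fun b s x => F b (shift s x)) (by
      intro b s c
      refine Eq.trans ?_ (hFk b c)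
      refine card_bij (fun x _ => shift s x) (by simp) (fun x _ y _ h => (shift s).injective h) ?_
      intro x hx
      exact ⟨(shift s).symm x, by simpa using hx, by simp⟩)
    (fun s x => hFinj (shift s x)) (by simp)
  let A : Fin k → Fin k → Fin k → Fin k → Option σ := fun b ρ s c =>
    if (b : ℕ) < l then some (S b ρ s c)
    else if (b : ℕ) = l ∧ (ρ : ℕ) < r then some (ψ (c, ρ + s)) else none
  have hA : ∀ b ρ s c x, A b ρ s c = some x → ((b : ℕ) < l ∧ S b ρ s c = x) ∨
      ((b : ℕ) = l ∧ (ρ : ℕ) < r ∧ ψ (c, ρ + s) = x) := by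
    intro b ρ s c x hx
    simp only [A] at hx
    split_ifs at hx with h1 h2
    · exact Or.inl ⟨h1, Option.some_injective _ hx⟩
    · exact Or.inr ⟨h2.1, h2.2, Option.some_injective _ hx⟩
  have hmixed : ∀ b ρ ρ' s c : Fin k, (b : ℕ) < l → (ρ' : ℕ) < r → S b ρ s c ≠ ψ (c, ρ' + s) := by
    intro b ρ ρ' s c hb hρ' he
    have h1 := hSF b ρ s c
    rw [he] at h1
    simp only [hshift] at h1
    exact hψ b c ρ' hb hρ' h1
  refine ⟨A, ⟨?_, ?_, ?_⟩, ?_, ?_⟩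
  · intro b ρ s c s' c' x h1 h2
    rcases hA _ _ _ _ _ h1 with ⟨hb, h1⟩ | ⟨hb, hρ, h1⟩ <;>
      rcases hA _ _ _ _ _ h2 with ⟨hb', h2⟩ | ⟨hb', hρ', h2⟩
    · exact hS.row b ρ s c s' c' x (congrArg some h1) (congrArg some h2)
    · omega
    · omega
    · have := ψ.injective (h1.trans h2.symm)
      simp only [Prod.mk.injEq, add_right_inj] at this
      exact ⟨this.2, this.1⟩
  · intro b ρ b' ρ' s c x h1 h2
    rcases hA _ _ _ _ _ h1 with ⟨hb, h1⟩ | ⟨hb, hρ, h1⟩ <;>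
      rcases hA _ _ _ _ _ h2 with ⟨hb', h2⟩ | ⟨hb', hρ', h2⟩
    · exact hS.column b ρ b' ρ' s c x (congrArg some h1) (congrArg some h2)
    · exact absurd (h1.trans h2.symm) (hmixed _ _ _ _ _ hb hρ')
    · exact absurd (h2.trans h1.symm) (hmixed _ _ _ _ _ hb' hρ)
    · have := ψ.injective (h1.trans h2.symm)
      simp only [Prod.mk.injEq, add_left_inj] at this
      exact ⟨Fin.ext (hb.trans hb'.symm), this.2⟩
  · intro b ρ ρ' s c c' x h1 h2
    rcases hA _ _ _ _ _ h1 with ⟨hb, h1⟩ | ⟨hb, hρ, h1⟩ <;>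
      rcases hA _ _ _ _ _ h2 with ⟨hb', h2⟩ | ⟨hb', hρ', h2⟩
    · exact hS.block b ρ ρ' s c c' x (congrArg some h1) (congrArg some h2)
    · omega
    · omega
    · have := ψ.injective (h1.trans h2.symm)
      simp only [Prod.mk.injEq, add_left_inj] at this
      exact ⟨this.2, this.1⟩
  · intro b ρ s c
    simp only [A]
    split_ifs with h1 h2
    · simp [h1]
    · simp [h2]
    · simp only [ne_eq, not_true_eq_false, h1, h2, or_self]
  · intro S' hS' hext
    have hbij : ∀ b, Function.Bijective fun p : Fin k × Fin k => S' b p.1 0 p.2 := by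
      intro b
      refine (Fintype.bijective_iff_injective_and_card _).2 ⟨?_, by simp [hσ]⟩
      rintro ⟨ρ, c⟩ ⟨ρ', c'⟩ he
      have := hS'.block b ρ ρ' 0 c c' _ rfl (congrArg some he.symm)
      exact Prod.ext this.1 this.2
    let β : Fin k := ⟨l, by omega⟩
    have hcard : #(({ρ : Fin k | r ≤ (ρ : ℕ)} : Finset (Fin k)) ×ˢ
        ({c : Fin k | l ≤ (c : ℕ)} : Finset (Fin k))) = (k - r) * (k - l) := by
      have hge : ∀ j ≤ k, #({c : Fin k | j ≤ (c : ℕ)} : Finset (Fin k)) = k - j := by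
        intro j hj
        have := card_filter_add_card_filter_not (s := (univ : Finset (Fin k)))
          (fun c => (c : ℕ) < j)
        simp only [not_lt] at this
        rw [Fin.card_filter_val_lt, card_univ, Fintype.card_fin] at this
        omega
      rw [card_product, hge r hrk.le, hge l (by omega)]
    rw [← hcard] at hXcard
    refine absurd hXcard (not_lt.2 ?_)
    choose loc hloc using (hbij β).2
    -- Pigeonhole in block `(l, 0)`: the first `r` rows contain no symbol of `X`, and each of the
    -- first `l` columns already contains all of `X` in an earlier band.
    refine card_le_card_of_injOn loc ?_ ?_
    · intro x hx
      rw [mem_coe] at hx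
      have hx1 : S' β (loc x).1 0 (loc x).2 = x := hloc x
      simp only [coe_product, Set.mem_prod, coe_filter, mem_univ, true_and, Set.mem_ofPred_eq]
      constructor
      · by_contra! hcon
        have h1 : A β (loc x).1 0 (loc x).2 = some (ψ ((loc x).2, (loc x).1)) := by
          simp [A, β, hcon]
        have h2 := hext _ _ _ _ _ h1
        rw [hx1] at h2
        have h3 := hXr x hx
        rw [h2, Equiv.symm_apply_apply] at h3
        simp only at h3
        omega
      · by_contra! hcon
        obtain ⟨b, hb, hbx⟩ := hXl x hx _ hcon
        obtain ⟨⟨ρ, c⟩, hp⟩ := (hbij b).2 x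
        have hp' : S' b ρ 0 c = x := hp
        have h1 : A b ρ 0 c = some (S b ρ 0 c) := by simp [A, hb]
        have h2 := hext _ _ _ _ _ h1
        have h3 := hSF b ρ 0 c
        simp only [hshift0] at h3
        rw [← h2, hp', hbx] at h3
        have h4 := (hS'.column b ρ β (loc x).1 0 c x (congrArg some hp')
          (congrArg some (by rw [← h3]; exact hx1))).1
        rw [h4] at hb
        exact lt_irrefl _ hb
    · intro x _ y _ he
      rw [← hloc x, ← hloc y, he]

/-! ### The characterization -/

theorem theorem3 (k n m l r : ℕ) (hn : n = k ^ 2) (hm : m = l * k + r) (hl : l < k)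
    (hr : r < k) :
    (∀ R : PartialMatrix n, IsSudokuRectangle k m R → IsCompletable k R) ↔
      (l = k - 1 ∨ r = 0 ∨ (k - r) * (k - l) ≥ l * k) := by
  constructor
  · intro hcomp
    by_contra! hcon
    obtain ⟨h1, h2, h3⟩ := hcon
    have hl0 : 1 ≤ l := by
      rcases Nat.eq_zero_or_pos l with rfl | h
      · simp at h3
      · exact h
    obtain ⟨A, hA, hfill, hno⟩ := exists_array_without_completion (card_symbols hn) hl0
      (by omega) (by omega : 1 ≤ r) hr h3
    obtain ⟨S, hS, hext⟩ := hcomp (fun i j => A (blockEquiv hn i).1 (blockEquiv hn i).2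
      (blockEquiv hn j).1 (blockEquiv hn j).2)
      ⟨(isPartialSudokuSquare_iff hn A).2 hA,
        fun i j hi => (hfill _ _ _ _).2 ((lt_iff_blockEquiv hn hr i).1 (hm ▸ hi)),
        fun i j hi => by
          by_contra h
          have := (lt_iff_blockEquiv hn hr i).2 ((hfill _ _ _ _).1 h)
          omega⟩
    let S' : Fin k → Fin k → Fin k → Fin k → Fin n := fun b ρ s c =>
      S ((blockEquiv hn).symm (b, ρ)) ((blockEquiv hn).symm (s, c))
    refine hno S' ((isPartialSudokuSquare_iff hn fun b ρ s c => some (S' b ρ s c)).1 ?_) ?_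
    · have : (fun i j => some (S' (blockEquiv hn i).1 (blockEquiv hn i).2
          (blockEquiv hn j).1 (blockEquiv hn j).2) : PartialMatrix n) = filled S := by
        funext i j
        simp [S', filled]
      rw [this]
      exact hS
    · intro b ρ s c x hx
      have := hext ((blockEquiv hn).symm (b, ρ)) ((blockEquiv hn).symm (s, c)) (by simp [hx])
      simp only [Equiv.apply_symm_apply, hx] at this
      exact (Option.some_injective _ this).symm
  · intro h
    refine isCompletable_of_le hn hm hl hr ?_
    rcases h with rfl | rfl | h
    · left
      have : k - (k - 1) = 1 := by omega
      simp [this]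
    · simp
    · exact Or.inr h
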